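/- Consider $m\ge 1$ walkers in $\mathbb Z$ starting from $x=(x_1<\dots<x_m)$; at each time step exactly one walker moves, one unit to the left or to the right, the $2m$ possible moves being equally likely and successive moves independent. For $y=(y_1<\dots<y_m)$ in $\mathbb Z^m$ and $T\ge 0$ let $P_x(y,T)$ be the probability that the $k$-th walker is at $y_k$ at time $T$ for every $k$ and that no two walkers occupy the same site at any of the times $0,\dots,T$. For partitions $\lambda\supseteq\mu$ let $f^{\lambda\setminus\mu}$ be the number of standard skew tableaux of shape $\lambda\setminus\mu$, i.e. fillings of its boxes with $1,\dots,|\lambda\setminus\mu|$, each used once, that increase strictly along rows and down columns. Put $f^\lambda=f^{\lambda\setminus\emptyset}$, and let $\lambda^\top_1$ be the number of rows (length of the first column) of $\lambda$. For a permutation $\pi$ let $L(\pi)$ be the length of a longest strictly increasing subsequence of $\pi$. (1) Let $c$ be an integer such that $$\mu_k=c+k-1-x_k,\qquad \nu_k=c+k-1-y_k\qquad(1\le k\le m)$$ are all nonnegative, so that $\mu=(\mu_1\ge\dots\ge\mu_m)$ and $\nu=(\nu_1\ge\dots\ge\nu_m)$ are partitions (zero parts allowed). Put $T_L=\frac12\bigl(T+\sum_{i=1}^m(x_i-y_i)\bigr)$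 and $T_R=\frac12\bigl(T-\sum_{i=1}^m(x_i-y_i)\bigr)$. If $T_L$ and $T_R$ are nonnegative integers, then $T_L=\frac12(T-|\mu|+|\nu|)$, $T_R=\frac12(T+|\mu|-|\nu|)$, $T=T_L+T_R$, $\sum_{i=1}^m(x_i-y_i)=T_L-T_R$, and $$P_x(y,T)=\frac1{(2m)^T}\binom{T}{T_L}\sum_{\substack{\lambda\supseteq\mu,\nu\\ |\lambda\setminus\mu|=T_L,\ |\lambda\setminus\nu|=T_R\\ \lambda^\top_1\le m}} f^{\lambda\setminus\mu}f^{\lambda\setminus\nu}.$$ Otherwise $P_x(y,T)=0$. (2) (Close packing.) For every $n\ge 0$, $$P_{(1,\dots,m)}\bigl((1,\dots,m),2n\bigr)=\frac1{(2m)^{2n}}\binom{2n}{n}\sum_{\substack{\lambda\vdash n\\ \lambda^\top_1\le m}}(f^\lambda)^2=\frac{(2n)!}{(n!)^2}\,\frac{\#\{\pi\in S_n: L(\pi)\le m\}}{(2m)^{2n}}.$$ -/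

import Mathlib

open MeasureTheory

noncomputable section

/-! ### Skew diagrams, standard tableaux, increasing subsequences -/

/-- The boxes of the skew diagram `lam \ mu` (used for `mu ≤ lam`). -/
def skewCells (lam mu : YoungDiagram) : Finset (ℕ × ℕ) :=
  lam.cells \ mu.cells

/-- A filling of a finite set `D` of boxes `(row, column)` with the `#D` consecutive labels, each
used exactly once, is standard if the labels strictly increase along each row from left to right
and down each column. (The label set `Fin #D` stands for `1, …, #D`.) -/
def IsStandardFilling (D : Finset (ℕ × ℕ)) (F : {c // c ∈ D} ≃ Fin D.card) : Prop :=
  (∀ a b : {c // c ∈ D}, a.1.1 = b.1.1 → a.1.2 < b.1.2 → F a < F b) ∧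
  (∀ a b : {c // c ∈ D}, a.1.2 = b.1.2 → a.1.1 < b.1.1 → F a < F b)

/-- `f^{lam \ mu}`: the number of standard skew tableaux of shape `lam \ mu`. -/
def numSkewSYT (lam mu : YoungDiagram) : ℕ :=
  Nat.card {F : {c // c ∈ skewCells lam mu} ≃ Fin (skewCells lam mu).card //
    IsStandardFilling (skewCells lam mu) F}

/-- `f^lam`: the number of standard tableaux of shape `lam`. -/
def numSYT (lam : YoungDiagram) : ℕ :=
  Nat.card {F : {c // c ∈ lam.cells} ≃ Fin lam.cells.card // IsStandardFilling lam.cells F}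

/-- There are finitely many partitions of `n`. -/
theorem finite_youngDiagram_card_eq (n : ℕ) : {lam : YoungDiagram | lam.card = n}.Finite := by
  refine Set.Finite.of_finite_image (f := YoungDiagram.cells) ?_
    (fun a _ b _ h => YoungDiagram.ext h)
  refine ((Finset.range n ×ˢ Finset.range n).powerset.finite_toSet).subset ?_
  rintro _ ⟨lam, hlam, rfl⟩
  simp only [Finset.coe_powerset, Set.mem_preimage, Set.mem_powerset_iff]
  rintro ⟨i, j⟩ hij
  have hlam' : lam.cells.card = n := hlam
  have hij' : (i, j) ∈ lam := hij
  have hi : i < n := by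
    have h1 : lam.col j ⊆ lam.cells := Finset.filter_subset _ _
    have h2 := Finset.card_le_card h1
    rw [← YoungDiagram.colLen_eq_card] at h2
    have h3 := YoungDiagram.mem_iff_lt_colLen.1 hij'
    omega
  have hj : j < n := by
    have h1 : lam.row i ⊆ lam.cells := Finset.filter_subset _ _
    have h2 := Finset.card_le_card h1
    rw [← YoungDiagram.rowLen_eq_card] at h2
    have h3 := YoungDiagram.mem_iff_lt_rowLen.1 hij'
    omega
  simp [hi, hj]

/-- The partitions `lam ⊢ n` with at most `m` rows (the first column has length at most `m`). -/
def partitionsWithin (m n : ℕ) : Finset YoungDiagram :=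
  ((finite_youngDiagram_card_eq n).subset
    (fun _ h => h.1 : {lam : YoungDiagram | lam.card = n ∧ lam.colLen 0 ≤ m} ⊆ _)).toFinset

/-- The partitions `lam` with `lam ⊇ mu`, `lam ⊇ nu`, `|lam \ mu| = TL`, `|lam \ nu| = TR` and at
most `m` rows form a finite set. -/
theorem finite_skewIndex (m : ℕ) (mu nu : YoungDiagram) (TL TR : ℕ) :
    {lam : YoungDiagram | mu ≤ lam ∧ nu ≤ lam ∧ (skewCells lam mu).card = TL ∧
      (skewCells lam nu).card = TR ∧ lam.colLen 0 ≤ m}.Finite := by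
  refine (finite_youngDiagram_card_eq (TL + mu.card)).subset ?_
  rintro lam ⟨h1, -, h2, -⟩
  have h := Finset.card_sdiff_add_card_eq_card (YoungDiagram.cells_subset_iff.2 h1)
  have h2' : (lam.cells \ mu.cells).card = TL := h2
  rw [h2'] at h
  exact h.symm

/-- The set of summation indices `lam`: `lam ⊇ mu`, `lam ⊇ nu`, `|lam \ mu| = TL`,
`|lam \ nu| = TR`, and the first column of `lam` has length at most `m`. -/
def skewIndex (m : ℕ) (mu nu : YoungDiagram) (TL TR : ℕ) : Finset YoungDiagram :=
  (finite_skewIndex m mu nu TL TR).toFinset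

open Classical in
/-- `L(π)`: the length of a longest strictly increasing subsequence of the permutation `π`. -/
def longestIncreasing {n : ℕ} (π : Equiv.Perm (Fin n)) : ℕ :=
  (Finset.univ.filter (fun s : Finset (Fin n) => StrictMonoOn π (s : Set (Fin n)))).sup
    Finset.card

/-! ### The random walk of `m` walkers -/

/-- A single move: which walker moves, and whether it moves right (`true`) or left (`false`). -/
abbrev WalkStep (m : ℕ) : Type := Fin m × Bool

/-- The displacement `± e_k` in `ℤ^m` of a move. -/
def stepVec {m : ℕ} (s : WalkStep m) : Fin m → ℤ :=
  Pi.single s.1 (if s.2 then 1 else -1)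

/-- The positions of the `m` walkers at time `t`, starting from `x`, for the move sequence `ω`. -/
def walkPos {m : ℕ} (x : Fin m → ℤ) (ω : ℕ → WalkStep m) (t : ℕ) : Fin m → ℤ :=
  x + ∑ s ∈ Finset.range t, stepVec (ω s)

/-- The law of the moves: independent, each uniform among the `2 * m` moves `± e_1, …, ± e_m`. -/
def moveLaw (m : ℕ) [NeZero m] : Measure (ℕ → WalkStep m) :=
  Measure.infinitePi (fun _ : ℕ => (PMF.uniformOfFintype (WalkStep m)).toMeasure)

/-- The event that the walkers started at `x` are at `y` at time `T` (walker `k` at `y k`), no two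
walkers occupying the same site at any of the times `0, …, T`. -/
def nonIntersectingEvent {m : ℕ} (x y : Fin m → ℤ) (T : ℕ) : Set (ℕ → WalkStep m) :=
  {ω | walkPos x ω T = y ∧ ∀ t ≤ T, Function.Injective (walkPos x ω t)}

/-- `P_x` (walkers started at `x` reach `y` in `T` steps, without ever intersecting). -/
def nonIntersectingProb {m : ℕ} [NeZero m] (x y : Fin m → ℤ) (T : ℕ) : ℝ :=
  (moveLaw m).real (nonIntersectingEvent x y T)

/-- The row lengths `c + (k - 1) - x_k`, `k = 1, …, m`, decrease weakly (here `k` starts at `0`). -/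
theorem walkRows_sortedGE {m : ℕ} (c : ℤ) (x : Fin m → ℤ) (hx : StrictMono x) :
    (List.ofFn (fun k : Fin m => (c + (k : ℤ) - x k).toNat)).SortedGE := by
  rw [List.sortedGE_ofFn_iff]
  have key : ∀ d : ℕ, ∀ i j : Fin m, (j : ℕ) = (i : ℕ) + d → x i + (d : ℤ) ≤ x j := by
    intro d
    induction d with
    | zero =>
      intro i j h
      have : j = i := Fin.ext (by omega)
      simp [this]
    | succ d ih =>
      intro i j h
      have hj := j.isLt
      have h1 := ih i ⟨(i : ℕ) + d, by omega⟩ rfl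
      have h2 : x ⟨(i : ℕ) + d, by omega⟩ < x j := hx (Fin.lt_def.2 (by simp; omega))
      push_cast
      omega
  intro i j hij
  have hij' : (i : ℕ) ≤ (j : ℕ) := hij
  have h := key ((j : ℕ) - (i : ℕ)) i j (by omega)
  apply Int.toNat_le_toNat
  omega

/-- The partition with parts `c + (k - 1) - x_k`, `k = 1, …, m`, attached to `x_1 < … < x_m`
(used when all of these are nonnegative; zero parts are allowed). -/
def walkPartition {m : ℕ} (c : ℤ) (x : Fin m → ℤ) (hx : StrictMono x) : YoungDiagram :=
  YoungDiagram.ofRowLens (List.ofFn (fun k : Fin m => (c + (k : ℤ) - x k).toNat))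
    (walkRows_sortedGE c x hx)

end

/-! Sort the move sequences by their words of directions, left or right. On strictly increasing
configurations, the operator summing over all admissible left moves commutes with the one summing
over all admissible right moves (`sum_right_left_comm`). For two different walkers the moves do not
interfere: a gap narrowed by one of them is not reopened by the other. For one walker moving back
and forth, what matters is that as many walkers can move left as can move right. Hence the number of
evolutions with a given word depends only on its numbers of left and right moves, which are fixed by
`T` and the total displacement. This gives the binomial coefficient times the number of evolutions
that make all left moves first (`numWalks_eq`).

In the dictionary between configurations and partitions, a left move adds a box and a right move
removes one; having `m` walkers means having at most `m` rows. The left phase climbs from `mu` to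
some `lam` and is a standard skew tableau; the right phase descends from `lam` to `nu` and is
another one (`numPaths_left_right_eq`). The probability is this count divided by the number of all
move sequences, because the event is a disjoint union of cylinders.

For close packing both end partitions are empty and the sum is over squares of numbers of standard
tableaux. Its value is the Robinson-Schensted correspondence, obtained here from growth diagrams: an
invertible local rule transports a permutation matrix to a pair of chains of diagrams with a common
end, and the first entries of the diagrams obey the last-passage recursion for increasing
subsequences. The entries are read as column lengths, so that the longest increasing subsequence
bounds the number of rows. -/

noncomputable section

/-! ### Linear extensions of a finite relation -/

/-- The number of injective labellings of `D` by `Fin n` that are increasing along `r`. -/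
def numLinExt {α : Type*} (r : α → α → Prop) (D : Finset α) (n : ℕ) : ℕ :=
  Nat.card {F : {c // c ∈ D} → Fin n //
    Function.Injective F ∧ ∀ a b : {c // c ∈ D}, r a.1 b.1 → F a < F b}

theorem numLinExt_empty {α : Type*} (r : α → α → Prop) : numLinExt r ∅ 0 = 1 := by
  rw [numLinExt, Nat.card_eq_one_iff_unique]
  exact ⟨⟨fun a b => Subtype.ext (funext fun c => absurd c.2 (Finset.notMem_empty _))⟩,
    ⟨⟨fun c => absurd c.2 (Finset.notMem_empty _),
      fun c => absurd c.2 (Finset.notMem_empty _),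
      fun c => absurd c.2 (Finset.notMem_empty _)⟩⟩⟩

/-- Reversing the labels reverses the relation. -/
theorem numLinExt_swap {α : Type*} (r : α → α → Prop) (D : Finset α) (n : ℕ) :
    numLinExt (fun a b => r b a) D n = numLinExt r D n := by
  refine Nat.card_congr ⟨fun F => ⟨fun c => Fin.rev (F.1 c), ?_, ?_⟩,
    fun F => ⟨fun c => Fin.rev (F.1 c), ?_, ?_⟩, ?_, ?_⟩
  · exact fun a b h => F.2.1 (Fin.rev_injective h)
  · exact fun a b h => Fin.rev_lt_rev.2 (F.2.2 b a h)
  · exact fun a b h => F.2.1 (Fin.rev_injective h)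
  · exact fun a b h => Fin.rev_lt_rev.2 (F.2.2 b a h)
  · exact fun F => Subtype.ext (funext fun c => Fin.rev_rev _)
  · exact fun F => Subtype.ext (funext fun c => Fin.rev_rev _)

open Classical in
/-- Removing the element with the largest label. -/
theorem numLinExt_succ {α : Type*} [DecidableEq α] (r : α → α → Prop) (D : Finset α) (n : ℕ)
    (hD : D.card = n + 1) :
    numLinExt r D (n + 1) =
      ∑ c ∈ D with ∀ b ∈ D, ¬ r c b, numLinExt r (D.erase c) n := by
  set M := D.filter (fun c => ∀ b ∈ D, ¬ r c b) with hM
  have hMD : ∀ c : {c // c ∈ M}, c.1 ∈ D := fun c => (Finset.mem_filter.1 c.2).1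
  have hMr : ∀ c : {c // c ∈ M}, ∀ b ∈ D, ¬ r c.1 b := fun c => (Finset.mem_filter.1 c.2).2
  let T : Finset α → ℕ → Type _ := fun D n => {F : {c // c ∈ D} → Fin n //
    Function.Injective F ∧ ∀ a b : {c // c ∈ D}, r a.1 b.1 → F a < F b}
  let ext : (c : {c // c ∈ M}) → T (D.erase c.1) n → {c // c ∈ D} → Fin (n + 1) :=
    fun c G a => if h : a.1 = c.1 then Fin.last n
      else (G.1 ⟨a.1, Finset.mem_erase.2 ⟨h, a.2⟩⟩).castSucc
  have ext_eq : ∀ c G a, a.1 = c.1 → ext c G a = Fin.last n := fun c G a h => by simp [ext, h]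
  have ext_ne : ∀ c G a (h : a.1 ≠ c.1),
      ext c G a = (G.1 ⟨a.1, Finset.mem_erase.2 ⟨h, a.2⟩⟩).castSucc :=
    fun c G a h => by simp [ext, h]
  -- Give the top label to a maximal `c` and keep the labelling of the rest; every labelling arises
  -- once, since its top label is attained and sits on a maximal element.
  let Φ : (Σ c : {c // c ∈ M}, T (D.erase c.1) n) → T D (n + 1) := fun p =>
    ⟨ext p.1 p.2, by
      intro a b hab
      by_cases ha : a.1 = p.1.1 <;> by_cases hb : b.1 = p.1.1
      · exact Subtype.ext (ha.trans hb.symm)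
      · rw [ext_eq _ _ _ ha, ext_ne _ _ _ hb] at hab
        exact absurd hab.symm (Fin.castSucc_lt_last _).ne
      · rw [ext_eq _ _ _ hb, ext_ne _ _ _ ha] at hab
        exact absurd hab (Fin.castSucc_lt_last _).ne
      · rw [ext_ne _ _ _ ha, ext_ne _ _ _ hb] at hab
        have := p.2.2.1 (Fin.castSucc_injective _ hab)
        exact Subtype.ext (by simpa using this), by
      intro a b hab
      have ha : a.1 ≠ p.1.1 := fun h => hMr p.1 b.1 b.2 (h ▸ hab)
      rw [ext_ne _ _ _ ha]
      by_cases hb : b.1 = p.1.1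
      · rw [ext_eq _ _ _ hb]; exact Fin.castSucc_lt_last _
      · rw [ext_ne _ _ _ hb]
        exact Fin.castSucc_lt_castSucc_iff.2 (p.2.2.2 _ _ hab)⟩
  have hΦ : Function.Bijective Φ := by
    constructor
    · rintro ⟨c, G⟩ ⟨c', G'⟩ h
      have h1 : ext c G = ext c' G' := congrArg Subtype.val h
      have hc : c = c' := by
        by_contra hne
        have h2 := congrFun h1 ⟨c.1, hMD c⟩
        rw [ext_eq _ _ _ rfl, ext_ne _ _ _ (fun h => hne (Subtype.ext h))] at h2
        exact (Fin.castSucc_lt_last _).ne h2.symm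
      subst hc
      congr 1
      apply Subtype.ext
      funext a
      have h2 := congrFun h1 ⟨a.1, (Finset.mem_erase.1 a.2).2⟩
      have ha := (Finset.mem_erase.1 a.2).1
      rw [ext_ne _ _ _ ha, ext_ne _ _ _ ha] at h2
      exact Fin.castSucc_injective _ h2
    · rintro ⟨F, hF, hr⟩
      have hb : Function.Bijective F := by
        rw [Fintype.bijective_iff_injective_and_card]
        exact ⟨hF, by simp [hD]⟩
      obtain ⟨c, hc⟩ := hb.2 (Fin.last n)
      have hcM : c.1 ∈ M := by
        rw [hM, Finset.mem_filter]
        refine ⟨c.2, fun b hb hcb => ?_⟩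
        have := hr c ⟨b, hb⟩ hcb
        rw [hc] at this
        exact absurd this (Fin.le_last _).not_gt
      have hne : ∀ a : {a // a ∈ D.erase c.1},
          F ⟨a.1, (Finset.mem_erase.1 a.2).2⟩ ≠ Fin.last n := fun a ha =>
        (Finset.mem_erase.1 a.2).1 (congrArg Subtype.val (hF (ha.trans hc.symm)))
      refine ⟨⟨⟨c.1, hcM⟩, ⟨fun a => (F ⟨a.1, (Finset.mem_erase.1 a.2).2⟩).castPred (hne a),
        fun a b hab => ?_, fun a b hab => ?_⟩⟩, ?_⟩
      · have := hF (Fin.castPred_inj.1 hab)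
        exact Subtype.ext (by simpa using this)
      · exact Fin.castPred_lt_castPred_iff.2 (hr _ _ hab)
      · apply Subtype.ext
        funext a
        by_cases ha : a.1 = c.1
        · refine (ext_eq _ _ _ ha).trans ?_
          rw [← hc]; congr 1; exact Subtype.ext ha.symm
        · refine (ext_ne _ _ _ ha).trans ?_
          simp
  have h1 : numLinExt r D (n + 1) = Nat.card (Σ c : {c // c ∈ M}, T (D.erase c.1) n) :=
    (Nat.card_eq_of_bijective Φ hΦ).symm
  rw [h1, Nat.card_sigma, ← Finset.sum_coe_sort M (fun c => numLinExt r (D.erase c) n)]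
  rfl

open Classical in
/-- Removing the element with the smallest label. -/
theorem numLinExt_succ' {α : Type*} [DecidableEq α] (r : α → α → Prop) (D : Finset α) (n : ℕ)
    (hD : D.card = n + 1) :
    numLinExt r D (n + 1) =
      ∑ c ∈ D with ∀ b ∈ D, ¬ r b c, numLinExt r (D.erase c) n := by
  rw [← numLinExt_swap, numLinExt_succ _ _ _ hD]
  exact Finset.sum_congr rfl fun c _ => numLinExt_swap _ _ _

/-- The relation between boxes that a standard filling respects. -/
def boxLT (a b : ℕ × ℕ) : Prop :=
  (a.1 = b.1 ∧ a.2 < b.2) ∨ (a.2 = b.2 ∧ a.1 < b.1)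

/-- In `numLinExt` the number of labels is a free parameter and the labelling a mere function, so
removing a box needs no transport along an equality of cardinalities. -/
theorem card_isStandardFilling (D : Finset (ℕ × ℕ)) :
    Nat.card {F : {c // c ∈ D} ≃ Fin D.card // IsStandardFilling D F} =
      numLinExt boxLT D D.card := by
  refine Nat.card_congr ⟨fun F => ⟨F.1, F.1.injective, ?_⟩,
    fun F => ⟨Equiv.ofBijective F.1 ?_, ?_⟩, ?_, ?_⟩
  · rintro a b (h | h)
    · exact F.2.1 a b h.1 h.2
    · exact F.2.2 a b h.1 h.2
  · rw [Fintype.bijective_iff_injective_and_card]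
    exact ⟨F.2.1, by simp⟩
  · exact ⟨fun a b h h' => F.2.2 a b (Or.inl ⟨h, h'⟩),
      fun a b h h' => F.2.2 a b (Or.inr ⟨h, h'⟩)⟩
  · exact fun F => Subtype.ext (Equiv.ext fun a => rfl)
  · exact fun F => rfl

theorem numSkewSYT_eq (lam mu : YoungDiagram) :
    numSkewSYT lam mu = numLinExt boxLT (skewCells lam mu) (skewCells lam mu).card :=
  card_isStandardFilling _

theorem numSYT_eq_numSkewSYT_bot (lam : YoungDiagram) : numSYT lam = numSkewSYT lam ⊥ := by
  rw [numSkewSYT_eq, numSYT, card_isStandardFilling]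
  have : skewCells lam ⊥ = lam.cells := by simp [skewCells]
  rw [this]

/-- `lam` arises from `mu` by adding one box. -/
def AddsBox (mu lam : YoungDiagram) : Prop := mu ≤ lam ∧ lam.card = mu.card + 1

theorem AddsBox.exists_cell {mu lam : YoungDiagram} (h : AddsBox mu lam) :
    ∃ c, c ∉ mu.cells ∧ lam.cells = insert c mu.cells := by
  have h1 := YoungDiagram.cells_subset_iff.2 h.1
  have h2 : (lam.cells \ mu.cells).card = 1 := by
    have := Finset.card_sdiff_add_card_eq_card h1
    have h3 : lam.cells.card = mu.cells.card + 1 := h.2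
    omega
  obtain ⟨c, hc⟩ := Finset.card_eq_one.1 h2
  refine ⟨c, ?_, ?_⟩
  · have : c ∈ lam.cells \ mu.cells := by simp [hc]
    exact (Finset.mem_sdiff.1 this).2
  · rw [← Finset.sdiff_union_of_subset h1, hc]; rfl

theorem addsBox_of_cells {mu lam : YoungDiagram} {c : ℕ × ℕ} (hc : c ∉ mu.cells)
    (h : lam.cells = insert c mu.cells) : AddsBox mu lam := by
  refine ⟨YoungDiagram.cells_subset_iff.1 (h ▸ Finset.subset_insert _ _), ?_⟩
  change lam.cells.card = mu.cells.card + 1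
  rw [h, Finset.card_insert_of_notMem hc]

theorem finite_addsBox_down (lam : YoungDiagram) : {mu | AddsBox mu lam}.Finite :=
  (finite_youngDiagram_card_eq (lam.card - 1)).subset fun mu h => by
    have := h.2
    change mu.card = _
    omega

theorem finite_addsBox_up (mu : YoungDiagram) : {lam | AddsBox mu lam}.Finite :=
  (finite_youngDiagram_card_eq (mu.card + 1)).subset fun _ h => h.2

/-- The diagrams obtained by removing a box. -/
def downSet (lam : YoungDiagram) : Finset YoungDiagram := (finite_addsBox_down lam).toFinset

/-- The diagrams obtained by adding a box. -/
def upSet (mu : YoungDiagram) : Finset YoungDiagram := (finite_addsBox_up mu).toFinset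

theorem mem_downSet {mu lam : YoungDiagram} : mu ∈ downSet lam ↔ AddsBox mu lam := by
  simp [downSet]

theorem mem_upSet {mu lam : YoungDiagram} : lam ∈ upSet mu ↔ AddsBox mu lam := by
  simp [upSet]

/-- Removing a maximal box of `lam \ nu` from `lam`. -/
theorem exists_erase_box {lam nu : YoungDiagram} {c : ℕ × ℕ}
    (hc : c ∈ skewCells lam nu) (hmax : ∀ b ∈ skewCells lam nu, ¬ boxLT c b) :
    ∃ mu : YoungDiagram, mu.cells = lam.cells.erase c := by
  obtain ⟨hcl, hcn⟩ := Finset.mem_sdiff.1 hc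
  -- Maximality extends from the skew diagram to all of `lam`: a box of `nu` beyond `c` would put
  -- `c` into `nu`.
  have key : ∀ b ∈ lam.cells, ¬ boxLT c b := by
    intro b hb hcb
    by_cases hbn : b ∈ nu.cells
    · apply hcn
      rcases hcb with h | h
      · exact nu.up_left_mem h.1.le h.2.le hbn
      · exact nu.up_left_mem h.2.le h.1.le hbn
    · exact hmax b (Finset.mem_sdiff.2 ⟨hb, hbn⟩) hcb
  refine ⟨⟨lam.cells.erase c, ?_⟩, rfl⟩
  intro a b hba ha
  obtain ⟨hac, hal⟩ := Finset.mem_erase.1 ha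
  obtain ⟨h1, h2⟩ := Prod.le_def.1 hba
  refine Finset.mem_erase.2 ⟨?_, lam.isLowerSet hba hal⟩
  rintro rfl
  -- `boxLT` compares only within a row or a column; the corner `(b.1, a.2)` reduces the product
  -- order to it.
  rcases h2.lt_or_eq with h2 | h2
  · refine key (b.1, a.2) (lam.up_left_mem h1 le_rfl hal) (Or.inl ⟨rfl, h2⟩)
  · rcases h1.lt_or_eq with h1 | h1
    · exact key a hal (Or.inr ⟨h2, h1⟩)
    · exact hac (Prod.ext h1.symm h2.symm)

/-- Adding a minimal box of `lam \ mu` to `mu`. -/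
theorem exists_insert_box {lam mu : YoungDiagram} {c : ℕ × ℕ}
    (hc : c ∈ skewCells lam mu) (hmin : ∀ b ∈ skewCells lam mu, ¬ boxLT b c) :
    ∃ nu : YoungDiagram, nu.cells = insert c mu.cells := by
  obtain ⟨hcl, hcn⟩ := Finset.mem_sdiff.1 hc
  have key : ∀ b, boxLT b c → b ∈ mu.cells := by
    intro b hbc
    by_contra hbn
    refine hmin b (Finset.mem_sdiff.2 ⟨?_, hbn⟩) hbc
    rcases hbc with h | h
    · exact lam.up_left_mem h.1.le h.2.le hcl
    · exact lam.up_left_mem h.2.le h.1.le hcl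
  refine ⟨⟨insert c mu.cells, ?_⟩, rfl⟩
  intro a b hba ha
  rcases Finset.mem_insert.1 ha with rfl | ha
  · obtain ⟨h1, h2⟩ := Prod.le_def.1 hba
    rcases h2.lt_or_eq with h2 | h2
    · exact Finset.mem_insert_of_mem (mu.up_left_mem h1 le_rfl (key (a.1, b.2) (Or.inl ⟨rfl, h2⟩)))
    · rcases h1.lt_or_eq with h1 | h1
      · exact Finset.mem_insert_of_mem (key b (Or.inr ⟨h2, h1⟩))
      · exact Finset.mem_insert.2 (Or.inl (Prod.ext h1 h2))
  · exact Finset.mem_insert_of_mem (mu.isLowerSet hba ha)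

open Classical in
-- The largest label occupies a removable corner of `lam` outside `nu`; delete it.
theorem numSkewSYT_eq_sum_down {lam nu : YoungDiagram} (hle : nu ≤ lam) (hne : lam.card ≠ nu.card) :
    numSkewSYT lam nu = ∑ mu ∈ downSet lam with nu ≤ mu, numSkewSYT mu nu := by
  have hsub := YoungDiagram.cells_subset_iff.2 hle
  obtain ⟨n, hn⟩ : ∃ n, (skewCells lam nu).card = n + 1 := by
    refine Nat.exists_eq_succ_of_ne_zero fun h0 => hne ?_
    have := Finset.card_sdiff_add_card_eq_card hsub
    change (lam.cells \ nu.cells).card = 0 at h0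
    change lam.cells.card = nu.cells.card
    omega
  rw [numSkewSYT_eq, hn, numLinExt_succ _ _ _ hn]
  have ex : ∀ c ∈ (skewCells lam nu).filter (fun c => ∀ b ∈ skewCells lam nu, ¬ boxLT c b),
      ∃ mu : YoungDiagram, mu.cells = lam.cells.erase c := fun c hc =>
    exists_erase_box (Finset.mem_filter.1 hc).1 (Finset.mem_filter.1 hc).2
  choose! e he using ex
  refine Finset.sum_bij (fun c _ => e c) ?_ ?_ ?_ ?_
  · intro c hc
    obtain ⟨hcl, hcn⟩ := Finset.mem_sdiff.1 (Finset.mem_filter.1 hc).1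
    rw [Finset.mem_filter, mem_downSet]
    refine ⟨addsBox_of_cells (c := c) (by simp [he c hc]) ?_, ?_⟩
    · rw [he c hc, Finset.insert_erase hcl]
    · rw [← YoungDiagram.cells_subset_iff, he c hc]
      exact fun b hb => Finset.mem_erase.2 ⟨fun h => hcn (h ▸ hb), hsub hb⟩
  · intro c hc c' hc' h
    have h1 : lam.cells.erase c = lam.cells.erase c' := by rw [← he c hc, ← he c' hc', h]
    have hcl := (Finset.mem_sdiff.1 (Finset.mem_filter.1 hc).1).1
    by_contra hne
    have : c ∈ lam.cells.erase c' := Finset.mem_erase.2 ⟨hne, hcl⟩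
    rw [← h1] at this
    exact (Finset.notMem_erase c _) this
  · intro mu hmu
    rw [Finset.mem_filter, mem_downSet] at hmu
    obtain ⟨c, hc, hcells⟩ := hmu.1.exists_cell
    have hcn : c ∉ nu.cells := fun h => hc (YoungDiagram.cells_subset_iff.2 hmu.2 h)
    have hcm : c ∈ (skewCells lam nu).filter (fun c => ∀ b ∈ skewCells lam nu, ¬ boxLT c b) := by
      rw [Finset.mem_filter]
      refine ⟨Finset.mem_sdiff.2 ⟨by simp [hcells], hcn⟩, fun b hb hcb => ?_⟩
      have hb := (Finset.mem_sdiff.1 hb).1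
      rw [hcells, Finset.mem_insert] at hb
      rcases hb with rfl | hb
      · rcases hcb with h | h <;> exact absurd h.2 (lt_irrefl _)
      · apply hc
        rcases hcb with h | h
        · exact mu.up_left_mem h.1.le h.2.le hb
        · exact mu.up_left_mem h.2.le h.1.le hb
    refine ⟨c, hcm, YoungDiagram.ext ?_⟩
    rw [he c hcm, hcells, Finset.erase_insert hc]
  · intro c hc
    have hs : skewCells (e c) nu = (skewCells lam nu).erase c := by
      rw [skewCells, he c hc, skewCells, Finset.erase_sdiff_comm]
    rw [numSkewSYT_eq, hs, Finset.card_erase_of_mem (Finset.mem_filter.1 hc).1, hn]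
    rfl

open Classical in
-- The smallest label occupies a box of `lam` that can be added to `mu`; absorb it into `mu`.
theorem numSkewSYT_eq_sum_up {lam mu : YoungDiagram} (hle : mu ≤ lam) (hne : lam.card ≠ mu.card) :
    numSkewSYT lam mu = ∑ nu ∈ upSet mu with nu ≤ lam, numSkewSYT lam nu := by
  have hsub := YoungDiagram.cells_subset_iff.2 hle
  obtain ⟨n, hn⟩ : ∃ n, (skewCells lam mu).card = n + 1 := by
    refine Nat.exists_eq_succ_of_ne_zero fun h0 => hne ?_
    have := Finset.card_sdiff_add_card_eq_card hsub
    change (lam.cells \ mu.cells).card = 0 at h0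
    change lam.cells.card = mu.cells.card
    omega
  rw [numSkewSYT_eq, hn, numLinExt_succ' _ _ _ hn]
  have ex : ∀ c ∈ (skewCells lam mu).filter (fun c => ∀ b ∈ skewCells lam mu, ¬ boxLT b c),
      ∃ nu : YoungDiagram, nu.cells = insert c mu.cells := fun c hc =>
    exists_insert_box (Finset.mem_filter.1 hc).1 (Finset.mem_filter.1 hc).2
  choose! e he using ex
  refine Finset.sum_bij (fun c _ => e c) ?_ ?_ ?_ ?_
  · intro c hc
    obtain ⟨hcl, hcn⟩ := Finset.mem_sdiff.1 (Finset.mem_filter.1 hc).1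
    rw [Finset.mem_filter, mem_upSet]
    refine ⟨addsBox_of_cells hcn (he c hc), ?_⟩
    rw [← YoungDiagram.cells_subset_iff, he c hc]
    exact Finset.insert_subset hcl hsub
  · intro c hc c' hc' h
    have h1 : insert c mu.cells = insert c' mu.cells := by rw [← he c hc, ← he c' hc', h]
    have hcn := (Finset.mem_sdiff.1 (Finset.mem_filter.1 hc).1).2
    have : c ∈ insert c' mu.cells := h1 ▸ Finset.mem_insert_self _ _
    exact (Finset.mem_insert.1 this).resolve_right hcn
  · intro nu hnu
    rw [Finset.mem_filter, mem_upSet] at hnu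
    obtain ⟨c, hc, hcells⟩ := hnu.1.exists_cell
    have hcl : c ∈ lam.cells := YoungDiagram.cells_subset_iff.2 hnu.2 (by simp [hcells])
    have hcm : c ∈ (skewCells lam mu).filter (fun c => ∀ b ∈ skewCells lam mu, ¬ boxLT b c) := by
      rw [Finset.mem_filter]
      refine ⟨Finset.mem_sdiff.2 ⟨hcl, hc⟩, fun b hb hbc => ?_⟩
      obtain ⟨hbl, hbm⟩ := Finset.mem_sdiff.1 hb
      have hcn : c ∈ nu := by rw [← YoungDiagram.mem_cells, hcells]; simp
      have hbn : b ∈ nu.cells := by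
        rcases hbc with h | h
        · exact nu.up_left_mem h.1.le h.2.le hcn
        · exact nu.up_left_mem h.2.le h.1.le hcn
      rw [hcells, Finset.mem_insert] at hbn
      rcases hbn with rfl | hb
      · rcases hbc with h | h <;> exact absurd h.2 (lt_irrefl _)
      · exact hbm hb
    exact ⟨c, hcm, YoungDiagram.ext ((he c hcm).trans hcells.symm)⟩
  · intro c hc
    have hs : skewCells lam (e c) = (skewCells lam mu).erase c := by
      rw [skewCells, he c hc, skewCells, Finset.sdiff_insert]
    rw [numSkewSYT_eq, hs, Finset.card_erase_of_mem (Finset.mem_filter.1 hc).1, hn]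
    rfl

theorem numSkewSYT_self (lam : YoungDiagram) : numSkewSYT lam lam = 1 := by
  have : skewCells lam lam = ∅ := Finset.sdiff_self _
  rw [numSkewSYT_eq, this]
  exact numLinExt_empty _

/-! ### Commuting left and right moves -/

theorem strictMono_fin_iff {m : ℕ} {x : Fin m → ℤ} :
    StrictMono x ↔ ∀ i j : Fin m, (i : ℕ) + 1 = j → x i < x j := by
  refine ⟨fun h i j hij => h (Fin.lt_def.2 (by omega)), fun h => ?_⟩
  have key : ∀ d : ℕ, ∀ i j : Fin m, (j : ℕ) = (i : ℕ) + d + 1 → x i < x j := by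
    intro d
    induction d with
    | zero => exact fun i j hij => h i j (by omega)
    | succ d ih =>
      intro i j hij
      exact (ih i ⟨i + d + 1, by omega⟩ rfl).trans (h _ _ (by simp; omega))
  intro i j hij
  have hij' : (i : ℕ) < j := hij
  exact key (j - i - 1) i j (by omega)

theorem stepVec_true {m : ℕ} (k i : Fin m) :
    stepVec (k, true) i = if i = k then 1 else 0 := by
  simp [stepVec, Pi.single_apply]

theorem stepVec_false {m : ℕ} (k i : Fin m) :
    stepVec (k, false) i = if i = k then -1 else 0 := by
  simp [stepVec, Pi.single_apply]

open Classical in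
/-- The number of non-intersecting evolutions from `x` to `y` whose successive directions
(`true` for right, `false` for left) are prescribed by the list. -/
def numPaths {m : ℕ} : List Bool → (Fin m → ℤ) → (Fin m → ℤ) → ℕ
  | [], x, y => if x = y then 1 else 0
  | b :: w, x, y => ∑ k : Fin m,
      if StrictMono (x + stepVec (k, b)) then numPaths w (x + stepVec (k, b)) y else 0

/-- Only gaps between neighbours matter. The gap above `k` is the one narrowed by the right move,
and only a left move of `k` itself could widen it again; symmetrically for `l`. -/
theorem strictMono_of_right_left {m : ℕ} {x : Fin m → ℤ} (hx : StrictMono x) {k l : Fin m}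
    (hkl : k ≠ l) (h : StrictMono (x + stepVec (k, true) + stepVec (l, false))) :
    StrictMono (x + stepVec (k, true)) ∧ StrictMono (x + stepVec (l, false)) := by
  rw [strictMono_fin_iff] at hx h
  simp only [strictMono_fin_iff, Pi.add_apply, stepVec_true, stepVec_false] at h ⊢
  constructor
  · intro i j hij
    have h1 := hx i j hij
    have h2 := h i j hij
    split_ifs at * <;> subst_vars <;> omega
  · intro i j hij
    have h1 := hx i j hij
    have h2 := h i j hij
    split_ifs at * <;> subst_vars <;> omega

open Classical in
/-- As many walkers can move right as can move left. -/
theorem sum_strictMono_right_eq_left {m : ℕ} {x : Fin m → ℤ} (hx : StrictMono x) (a : ℕ) :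
    (∑ k : Fin m, if StrictMono (x + stepVec (k, true)) then a else 0) =
      ∑ k : Fin m, if StrictMono (x + stepVec (k, false)) then a else 0 := by
  cases m with
  | zero => rfl
  | succ n =>
    -- Walker `k` is blocked on the right exactly when walker `k + 1` is blocked on the left. The
    -- rotation pairs the last walker, free on the right, with the first, free on the left.
    rw [← Equiv.sum_comp (finRotate (n + 1))
      (fun k => if StrictMono (x + stepVec (k, false)) then a else 0)]
    refine Finset.sum_congr rfl fun k _ => if_congr ?_ rfl rfl
    have hx' := strictMono_fin_iff.1 hx
    simp only [strictMono_fin_iff, Pi.add_apply, stepVec_true, stepVec_false]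
    by_cases hk : k = Fin.last n
    · subst hk
      rw [finRotate_last]
      constructor
      · intro _ i j hij
        have h1 := hx' i j hij
        have : j ≠ 0 := by rintro rfl; simp at hij
        split_ifs <;> omega
      · intro _ i j hij
        have h1 := hx' i j hij
        have : i ≠ Fin.last n := by rintro rfl; have := j.isLt; simp at hij; omega
        split_ifs <;> omega
    · have hr : ((finRotate (n + 1) k : Fin (n + 1)) : ℕ) = k + 1 :=
        coe_finRotate_of_ne_last hk
      generalize finRotate (n + 1) k = l at hr
      constructor
      · intro h i j hij
        have h1 := h i j hij
        have h2 := hx' i j hij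
        have e1 : i = l → (i : ℕ) = k + 1 := fun e => e ▸ hr
        have e2 : j = l ↔ i = k := by rw [Fin.ext_iff, Fin.ext_iff]; omega
        by_cases hi : i = k
        · have : ¬ i = l := fun e => by have := e1 e; rw [hi] at this; omega
          rw [if_pos hi, if_neg (fun e => by rw [e, hi] at hij; omega)] at h1
          rw [if_neg this, if_pos (e2.2 hi)]
          omega
        · rw [if_neg (fun e => hi (e2.1 e))]
          split_ifs <;> omega
      · intro h i j hij
        have h1 := h i j hij
        have h2 := hx' i j hij
        have e1 : i = l → (i : ℕ) = k + 1 := fun e => e ▸ hr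
        have e2 : j = l ↔ i = k := by rw [Fin.ext_iff, Fin.ext_iff]; omega
        by_cases hi : i = k
        · have : ¬ i = l := fun e => by have := e1 e; rw [hi] at this; omega
          rw [if_neg this, if_pos (e2.2 hi)] at h1
          rw [if_pos hi, if_neg (fun e => by rw [e, hi] at hij; omega)]
          omega
        · rw [if_neg hi]
          split_ifs <;> omega

open Classical in
-- The terms with `k ≠ l` agree one by one, their intermediate configurations being automatically
-- admissible. The terms with `k = l` return to `x`, so both sides contribute `g x` times a number
-- of mobile walkers, and these numbers agree.
theorem sum_right_left_comm {m : ℕ} {x : Fin m → ℤ} (hx : StrictMono x) (g : (Fin m → ℤ) → ℕ) :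
    (∑ k : Fin m, if StrictMono (x + stepVec (k, true)) then
        ∑ l : Fin m, if StrictMono (x + stepVec (k, true) + stepVec (l, false)) then
          g (x + stepVec (k, true) + stepVec (l, false)) else 0
      else 0) =
    ∑ l : Fin m, if StrictMono (x + stepVec (l, false)) then
        ∑ k : Fin m, if StrictMono (x + stepVec (l, false) + stepVec (k, true)) then
          g (x + stepVec (l, false) + stepVec (k, true)) else 0
      else 0 := by
  have hcancel : ∀ k : Fin m, x + stepVec (k, true) + stepVec (k, false) = x := by
    intro k; funext i
    simp only [Pi.add_apply, stepVec_true, stepVec_false]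
    split_ifs <;> omega
  have hcancel' : ∀ k : Fin m, x + stepVec (k, false) + stepVec (k, true) = x := by
    intro k; rw [add_right_comm]; exact hcancel k
  have hL : (∑ k : Fin m, if StrictMono (x + stepVec (k, true)) then
        ∑ l : Fin m, if StrictMono (x + stepVec (k, true) + stepVec (l, false)) then
          g (x + stepVec (k, true) + stepVec (l, false)) else 0
      else 0) = (∑ k : Fin m, if StrictMono (x + stepVec (k, true)) then g x else 0) +
      ∑ k : Fin m, ∑ l ∈ Finset.univ.erase k,
        if StrictMono (x + stepVec (k, true) + stepVec (l, false)) then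
          g (x + stepVec (k, true) + stepVec (l, false)) else 0 := by
    rw [← Finset.sum_add_distrib]
    refine Finset.sum_congr rfl fun k _ => ?_
    split_ifs with hk
    · rw [← Finset.add_sum_erase _ _ (Finset.mem_univ k), hcancel k, if_pos hx]
    · rw [Finset.sum_eq_zero fun l hl => if_neg fun h => hk
        (strictMono_of_right_left hx (Finset.ne_of_mem_erase hl).symm h).1, add_zero]
  have hR : (∑ l : Fin m, if StrictMono (x + stepVec (l, false)) then
        ∑ k : Fin m, if StrictMono (x + stepVec (l, false) + stepVec (k, true)) then
          g (x + stepVec (l, false) + stepVec (k, true)) else 0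
      else 0) = (∑ k : Fin m, if StrictMono (x + stepVec (k, false)) then g x else 0) +
      ∑ l : Fin m, ∑ k ∈ Finset.univ.erase l,
        if StrictMono (x + stepVec (k, true) + stepVec (l, false)) then
          g (x + stepVec (k, true) + stepVec (l, false)) else 0 := by
    rw [← Finset.sum_add_distrib]
    refine Finset.sum_congr rfl fun l _ => ?_
    split_ifs with hl
    · rw [← Finset.add_sum_erase _ _ (Finset.mem_univ l), hcancel' l, if_pos hx]
      simp only [add_right_comm x (stepVec (l, false))]
    · rw [Finset.sum_eq_zero fun k hk => if_neg fun h => hl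
        (strictMono_of_right_left hx (Finset.ne_of_mem_erase hk) h).2, add_zero]
  rw [hL, hR, sum_strictMono_right_eq_left hx]
  congr 1
  refine Finset.sum_comm' fun k l => ?_
  simp [ne_comm]

theorem numPaths_swap {m : ℕ} {x : Fin m → ℤ} (hx : StrictMono x) (y : Fin m → ℤ)
    (a b : Bool) (w : List Bool) : numPaths (a :: b :: w) x y = numPaths (b :: a :: w) x y := by
  cases a <;> cases b
  · rfl
  · simpa only [numPaths] using (sum_right_left_comm hx (fun z => numPaths w z y)).symm
  · simpa only [numPaths] using sum_right_left_comm hx (fun z => numPaths w z y)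
  · rfl

/-- Adjacent swaps generate all permutations, and the guard in `numPaths` keeps the configuration
strictly increasing wherever a swap takes place. -/
theorem numPaths_perm {m : ℕ} {w w' : List Bool} (h : w.Perm w') {x : Fin m → ℤ}
    (hx : StrictMono x) (y : Fin m → ℤ) : numPaths w x y = numPaths w' x y := by
  induction h generalizing x with
  | nil => rfl
  | cons b _ ih =>
    rw [numPaths, numPaths]
    refine Finset.sum_congr rfl fun k _ => ?_
    split_ifs with hk
    · exact ih hk
    · rfl
  | swap a b w => exact numPaths_swap hx y _ _ _
  | trans _ _ ih1 ih2 => exact (ih1 hx).trans (ih2 hx)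

/-- Serves to discard right moves past `c + k`, which would correspond to a negative row: such a
walker cannot come back. -/
theorem numPaths_right_le {m : ℕ} (b : ℕ) {x y : Fin m → ℤ}
    (h : numPaths (List.replicate b true) x y ≠ 0) : x ≤ y := by
  induction b generalizing x with
  | zero =>
    by_contra hne
    refine h ?_
    simp only [List.replicate_zero, numPaths]
    exact if_neg fun e => hne e.le
  | succ b ih =>
    rw [List.replicate_succ, numPaths] at h
    obtain ⟨k, _, hk⟩ := Finset.exists_ne_zero_of_sum_ne_zero h
    have h1 := ih (x := x + stepVec (k, true)) fun h0 => hk (by rw [h0]; simp)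
    intro i
    change x i ≤ y i
    have h2 : (x + stepVec (k, true)) i ≤ y i := h1 i
    rw [Pi.add_apply, stepVec_true] at h2
    split_ifs at h2 <;> omega

/-! ### Diagrams with at most `m` rows as states of the walk -/

theorem rowLen_eq_zero_of_colLen_le {lam : YoungDiagram} {m i : ℕ} (h : lam.colLen 0 ≤ m)
    (hi : m ≤ i) : lam.rowLen i = 0 := by
  by_contra hne
  have h1 : (i, 0) ∈ lam := YoungDiagram.mem_iff_lt_rowLen.2 (Nat.pos_of_ne_zero hne)
  have := YoungDiagram.mem_iff_lt_colLen.1 h1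
  omega

theorem youngDiagram_le_iff_rowLen {mu lam : YoungDiagram} :
    mu ≤ lam ↔ ∀ i, mu.rowLen i ≤ lam.rowLen i := by
  constructor
  · intro h i
    by_contra hlt
    have h1 : (i, lam.rowLen i) ∈ mu := YoungDiagram.mem_iff_lt_rowLen.2 (not_le.1 hlt)
    have := YoungDiagram.mem_iff_lt_rowLen.1 (h h1)
    omega
  · rintro h ⟨i, j⟩ hij
    exact YoungDiagram.mem_iff_lt_rowLen.2
      ((YoungDiagram.mem_iff_lt_rowLen.1 hij).trans_le (h i))

theorem colLen_mono {mu lam : YoungDiagram} (h : mu ≤ lam) (j : ℕ) : mu.colLen j ≤ lam.colLen j := by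
  by_contra hlt
  have h1 : (lam.colLen j, j) ∈ mu := YoungDiagram.mem_iff_lt_colLen.2 (not_le.1 hlt)
  have := YoungDiagram.mem_iff_lt_colLen.1 (h h1)
  omega

theorem card_eq_sum_rowLen {lam : YoungDiagram} {m : ℕ} (h : lam.colLen 0 ≤ m) :
    lam.card = ∑ k : Fin m, lam.rowLen k := by
  rw [Fin.sum_univ_eq_sum_range (fun i => lam.rowLen i) m]
  change lam.cells.card = _
  rw [Finset.card_eq_sum_card_fiberwise (f := Prod.fst) (t := Finset.range m)]
  · refine Finset.sum_congr rfl fun i _ => ?_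
    rw [YoungDiagram.rowLen_eq_card]; rfl
  · rintro ⟨i, j⟩ hij
    simp only [Finset.coe_range, Set.mem_Iio]
    by_contra hlt
    have h1 := YoungDiagram.mem_iff_lt_rowLen.1 ((YoungDiagram.mem_cells _).1 hij)
    rw [rowLen_eq_zero_of_colLen_le h (not_lt.1 hlt)] at h1
    omega

/-- The positions of the walkers attached to a diagram with at most `m` rows. -/
def walkState (m : ℕ) (c : ℤ) (lam : YoungDiagram) : Fin m → ℤ :=
  fun k => c + (k : ℤ) - (lam.rowLen k : ℤ)

theorem walkState_strictMono (m : ℕ) (c : ℤ) (lam : YoungDiagram) :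
    StrictMono (walkState m c lam) := by
  rw [strictMono_fin_iff]
  intro i j hij
  have := lam.rowLen_anti i j (by omega)
  simp only [walkState]
  omega

theorem walkState_le_iff {m : ℕ} {c : ℤ} {mu lam : YoungDiagram} (hmu : mu.colLen 0 ≤ m) :
    walkState m c lam ≤ walkState m c mu ↔ mu ≤ lam := by
  rw [youngDiagram_le_iff_rowLen]
  constructor
  · intro h i
    by_cases hi : i < m
    · have := h ⟨i, hi⟩
      simp only [walkState] at this
      omega
    · rw [rowLen_eq_zero_of_colLen_le hmu (not_lt.1 hi)]
      exact Nat.zero_le _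
  · intro h k
    have := h k
    simp only [walkState]
    omega

theorem walkState_inj {m : ℕ} {c : ℤ} {mu lam : YoungDiagram} (hmu : mu.colLen 0 ≤ m)
    (hlam : lam.colLen 0 ≤ m) (h : walkState m c mu = walkState m c lam) : mu = lam :=
  le_antisymm ((walkState_le_iff hmu).1 h.ge) ((walkState_le_iff hlam).1 h.le)

theorem rowLen_walkPartition {m : ℕ} (c : ℤ) (x : Fin m → ℤ) (hx : StrictMono x) (k : Fin m) :
    (walkPartition c x hx).rowLen k = (c + (k : ℤ) - x k).toNat := by
  refine eq_of_forall_lt_iff fun j => ?_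
  rw [← YoungDiagram.mem_iff_lt_rowLen, walkPartition, YoungDiagram.mem_ofRowLens]
  simp

theorem colLen_walkPartition {m : ℕ} (c : ℤ) (x : Fin m → ℤ) (hx : StrictMono x) :
    (walkPartition c x hx).colLen 0 ≤ m := by
  by_contra hlt
  have h1 : (m, 0) ∈ walkPartition c x hx := YoungDiagram.mem_iff_lt_colLen.2 (not_le.1 hlt)
  rw [walkPartition, YoungDiagram.mem_ofRowLens] at h1
  simp at h1

theorem walkState_walkPartition {m : ℕ} {c : ℤ} {x : Fin m → ℤ} (hx : StrictMono x)
    (h : ∀ k : Fin m, x k ≤ c + (k : ℤ)) : walkState m c (walkPartition c x hx) = x := by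
  funext k
  have := h k
  simp only [walkState, rowLen_walkPartition]
  omega

/-- The new box lies in row `k` precisely when walker `k` is the one that steps left. -/
theorem addsBox_iff_walkState {m : ℕ} {c : ℤ} {mu lam : YoungDiagram} (hmu : mu.colLen 0 ≤ m)
    (hlam : lam.colLen 0 ≤ m) :
    AddsBox mu lam ↔ ∃ k, walkState m c lam = walkState m c mu + stepVec (k, false) := by
  rw [AddsBox, card_eq_sum_rowLen hmu, card_eq_sum_rowLen hlam]
  constructor
  · rintro ⟨hle, hcard⟩
    have hle := youngDiagram_le_iff_rowLen.1 hle
    obtain ⟨k, hk⟩ : ∃ k : Fin m, mu.rowLen k < lam.rowLen k := by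
      by_contra! hno
      have := Finset.sum_le_sum fun (k : Fin m) (_ : k ∈ Finset.univ) => hno k
      omega
    refine ⟨k, ?_⟩
    have h1 := Finset.sum_erase_add Finset.univ (fun k : Fin m => lam.rowLen k) (Finset.mem_univ k)
    have h2 := Finset.sum_erase_add Finset.univ (fun k : Fin m => mu.rowLen k) (Finset.mem_univ k)
    have h3 : ∑ i ∈ Finset.univ.erase k, mu.rowLen i ≤ ∑ i ∈ Finset.univ.erase k, lam.rowLen i :=
      Finset.sum_le_sum fun i _ => hle i
    -- Row `k` already uses up the single extra box, so the termwise inequalities for the other rows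
    -- are equalities.
    have h4 := (Finset.sum_eq_sum_iff_of_le (s := Finset.univ.erase k)
      (f := fun i : Fin m => mu.rowLen i) (g := fun i : Fin m => lam.rowLen i)
      fun i _ => hle i).1 (by omega)
    funext i
    simp only [walkState, Pi.add_apply, stepVec_false]
    by_cases hi : i = k
    · subst hi
      rw [if_pos rfl]
      omega
    · have := h4 i (Finset.mem_erase.2 ⟨hi, Finset.mem_univ i⟩)
      rw [if_neg hi]
      omega
  · rintro ⟨k, hk⟩
    have hr : ∀ i : Fin m, lam.rowLen i = mu.rowLen i + if i = k then 1 else 0 := by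
      intro i
      have := congrFun hk i
      simp only [walkState, Pi.add_apply, stepVec_false] at this
      split_ifs at this ⊢ <;> omega
    refine ⟨(walkState_le_iff (c := c) hmu).1 ?_, ?_⟩
    · intro i
      change walkState m c lam i ≤ walkState m c mu i
      have := congrFun hk i
      simp only [Pi.add_apply, stepVec_false] at this
      split_ifs at this <;> omega
    · rw [Finset.sum_congr rfl fun i _ => hr i, Finset.sum_add_distrib]
      simp

open Classical in
-- Left moves lengthen rows and stay among partitions. The filter removes the diagram with a new row
-- of index `m`, for which there is no walker.
theorem sum_left_eq_sum_upSet {m : ℕ} {c : ℤ} {mu : YoungDiagram} (hmu : mu.colLen 0 ≤ m)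
    (g : (Fin m → ℤ) → ℕ) :
    (∑ k : Fin m, if StrictMono (walkState m c mu + stepVec (k, false)) then
        g (walkState m c mu + stepVec (k, false)) else 0) =
      ∑ lam ∈ upSet mu with lam.colLen 0 ≤ m, g (walkState m c lam) := by
  rw [← Finset.sum_filter]
  have ex : ∀ k ∈ Finset.univ.filter
      (fun k : Fin m => StrictMono (walkState m c mu + stepVec (k, false))),
      ∃ lam : YoungDiagram, lam.colLen 0 ≤ m ∧
        walkState m c lam = walkState m c mu + stepVec (k, false) := by
    intro k hk
    refine ⟨walkPartition c _ (Finset.mem_filter.1 hk).2, colLen_walkPartition _ _ _,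
      walkState_walkPartition _ fun i => ?_⟩
    simp only [Pi.add_apply, stepVec_false, walkState]
    split_ifs <;> omega
  choose! e he using ex
  refine Finset.sum_bij (fun k _ => e k) ?_ ?_ ?_ ?_
  · intro k hk
    rw [Finset.mem_filter, mem_upSet]
    exact ⟨(addsBox_iff_walkState hmu (he k hk).1).2 ⟨k, (he k hk).2⟩, (he k hk).1⟩
  · intro k hk l hl h
    have h1 := (he k hk).2
    rw [h, (he l hl).2, add_right_inj] at h1
    have h2 := congrFun h1 k
    rw [stepVec_false, stepVec_false, if_pos rfl] at h2
    by_contra hne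
    rw [if_neg hne] at h2
    omega
  · intro lam hlam
    rw [Finset.mem_filter, mem_upSet] at hlam
    obtain ⟨k, hk⟩ := (addsBox_iff_walkState (c := c) hmu hlam.2).1 hlam.1
    have hkm : k ∈ Finset.univ.filter
        (fun k : Fin m => StrictMono (walkState m c mu + stepVec (k, false))) := by
      rw [Finset.mem_filter, ← hk]
      exact ⟨Finset.mem_univ _, walkState_strictMono _ _ _⟩
    exact ⟨k, hkm, walkState_inj (he k hkm).1 hlam.2 ((he k hkm).2.trans hk.symm)⟩
  · intro k hk
    rw [(he k hk).2]

open Classical in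
-- A walker whose row is empty may still be able to move right, which leaves the range of
-- partitions; `hg` makes such moves contribute nothing.
theorem sum_right_eq_sum_downSet {m : ℕ} {c : ℤ} {mu : YoungDiagram} (hmu : mu.colLen 0 ≤ m)
    (g : (Fin m → ℤ) → ℕ) (hg : ∀ z, g z ≠ 0 → ∀ k : Fin m, z k ≤ c + (k : ℤ)) :
    (∑ k : Fin m, if StrictMono (walkState m c mu + stepVec (k, true)) then
        g (walkState m c mu + stepVec (k, true)) else 0) =
      ∑ lam ∈ downSet mu, g (walkState m c lam) := by
  rw [← Finset.sum_filter]
  rw [← Finset.sum_filter_of_ne (f := fun k : Fin m => g (walkState m c mu + stepVec (k, true))) (p := fun k => ∀ i : Fin m,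
    (walkState m c mu + stepVec (k, true)) i ≤ c + (i : ℤ)) (fun k _ h => hg _ h)]
  rw [Finset.filter_filter]
  have ex : ∀ k ∈ Finset.univ.filter
      (fun k : Fin m => StrictMono (walkState m c mu + stepVec (k, true)) ∧
        ∀ i : Fin m, (walkState m c mu + stepVec (k, true)) i ≤ c + (i : ℤ)),
      ∃ lam : YoungDiagram, lam.colLen 0 ≤ m ∧
        walkState m c lam = walkState m c mu + stepVec (k, true) := by
    intro k hk
    exact ⟨walkPartition c _ (Finset.mem_filter.1 hk).2.1, colLen_walkPartition _ _ _,
      walkState_walkPartition _ (Finset.mem_filter.1 hk).2.2⟩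
  have hflip : ∀ (x y : Fin m → ℤ) (k : Fin m),
      x = y + stepVec (k, true) ↔ y = x + stepVec (k, false) := by
    intro x y k
    simp only [funext_iff, Pi.add_apply, stepVec_true, stepVec_false]
    refine forall_congr' fun i => ?_
    split_ifs <;> omega
  choose! e he using ex
  refine Finset.sum_bij (fun k _ => e k) ?_ ?_ ?_ ?_
  · intro k hk
    rw [mem_downSet]
    exact (addsBox_iff_walkState (he k hk).1 hmu).2 ⟨k, (hflip _ _ _).1 (he k hk).2⟩
  · intro k hk l hl h
    have h1 := (he k hk).2
    rw [h, (he l hl).2, add_right_inj] at h1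
    have h2 := congrFun h1 k
    rw [stepVec_true, stepVec_true, if_pos rfl] at h2
    by_contra hne
    rw [if_neg hne] at h2
    omega
  · intro lam hlam
    rw [mem_downSet] at hlam
    have hl : lam.colLen 0 ≤ m := (colLen_mono hlam.1 0).trans hmu
    obtain ⟨k, hk⟩ := (addsBox_iff_walkState (c := c) hl hmu).1 hlam
    have hk := (hflip _ _ _).2 hk
    have hkm : k ∈ Finset.univ.filter
      (fun k : Fin m => StrictMono (walkState m c mu + stepVec (k, true)) ∧
        ∀ i : Fin m, (walkState m c mu + stepVec (k, true)) i ≤ c + (i : ℤ)) := by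
      rw [Finset.mem_filter, ← hk]
      refine ⟨Finset.mem_univ _, walkState_strictMono _ _ _, fun i => ?_⟩
      simp only [walkState]
      omega
    exact ⟨k, hkm, walkState_inj (he k hkm).1 hl ((he k hkm).2.trans hk.symm)⟩
  · intro k hk
    rw [(he k hk).2]

open Classical in
theorem numPaths_right_eq {m : ℕ} {c : ℤ} {mu nu : YoungDiagram} (b : ℕ) (hmu : mu.colLen 0 ≤ m)
    (hnu : nu.colLen 0 ≤ m) :
    numPaths (List.replicate b true) (walkState m c mu) (walkState m c nu) =
      if nu ≤ mu ∧ mu.card = nu.card + b then numSkewSYT mu nu else 0 := by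
  induction b generalizing mu with
  | zero =>
    simp only [List.replicate_zero, numPaths]
    by_cases h : mu = nu
    · subst h
      simp [numSkewSYT_self]
    · rw [if_neg fun e => h (walkState_inj hmu hnu e), if_neg]
      rintro ⟨h1, h2⟩
      exact h (YoungDiagram.ext (Finset.eq_of_subset_of_card_le
        (YoungDiagram.cells_subset_iff.2 h1) h2.le).symm)
  | succ b ih =>
    rw [List.replicate_succ, numPaths, sum_right_eq_sum_downSet hmu
      (fun z => numPaths (List.replicate b true) z (walkState m c nu))]
    · rw [Finset.sum_congr rfl fun lam hlam => ih ((colLen_mono (mem_downSet.1 hlam).1 0).trans hmu)]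
      split_ifs with h
      · rw [numSkewSYT_eq_sum_down h.1 (by omega), Finset.sum_filter]
        refine Finset.sum_congr rfl fun lam hlam => if_congr ?_ rfl rfl
        have := (mem_downSet.1 hlam).2
        exact ⟨fun h => h.1, fun h => ⟨h, by omega⟩⟩
      · refine Finset.sum_eq_zero fun lam hlam => if_neg fun h' => h ?_
        have := mem_downSet.1 hlam
        exact ⟨h'.1.trans this.1, by have := this.2; omega⟩
    · intro z hz k
      have := numPaths_right_le b hz k
      simp only [walkState] at this
      omega

theorem card_skewCells_add {lam mu : YoungDiagram} (h : mu ≤ lam) :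
    (skewCells lam mu).card + mu.card = lam.card :=
  Finset.card_sdiff_add_card_eq_card (YoungDiagram.cells_subset_iff.2 h)

theorem mem_skewIndex {m : ℕ} {mu nu lam : YoungDiagram} {a b : ℕ} :
    lam ∈ skewIndex m mu nu a b ↔ mu ≤ lam ∧ nu ≤ lam ∧ lam.card = mu.card + a ∧
      lam.card = nu.card + b ∧ lam.colLen 0 ≤ m := by
  simp only [skewIndex, Set.Finite.mem_toFinset, Set.mem_ofPred_eq]
  constructor
  · rintro ⟨h1, h2, h3, h4, h5⟩
    have := card_skewCells_add h1
    have := card_skewCells_add h2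
    exact ⟨h1, h2, by omega, by omega, h5⟩
  · rintro ⟨h1, h2, h3, h4, h5⟩
    have := card_skewCells_add h1
    have := card_skewCells_add h2
    exact ⟨h1, h2, by omega, by omega, h5⟩

/-- The index `lam` is the diagram at the turning point. Without left moves it must be `mu`; each
further left move absorbs the smallest label of a filling of `lam \ mu`. -/
theorem numPaths_left_right_eq {m : ℕ} {c : ℤ} {mu nu : YoungDiagram} (a b : ℕ)
    (hmu : mu.colLen 0 ≤ m) (hnu : nu.colLen 0 ≤ m) :
    numPaths (List.replicate a false ++ List.replicate b true)
        (walkState m c mu) (walkState m c nu) =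
      ∑ lam ∈ skewIndex m mu nu a b, numSkewSYT lam mu * numSkewSYT lam nu := by
  classical
  induction a generalizing mu with
  | zero =>
    rw [List.replicate_zero, List.nil_append, numPaths_right_eq b hmu hnu]
    have huniq : ∀ lam ∈ skewIndex m mu nu 0 b, lam = mu := by
      intro lam hlam
      obtain ⟨h1, -, h2, -⟩ := mem_skewIndex.1 hlam
      exact (YoungDiagram.ext (Finset.eq_of_subset_of_card_le
        (YoungDiagram.cells_subset_iff.2 h1) h2.le)).symm
    split_ifs with h
    · have hs : skewIndex m mu nu 0 b = {mu} := by
        refine Finset.eq_singleton_iff_unique_mem.2 ⟨?_, huniq⟩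
        exact mem_skewIndex.2 ⟨le_rfl, h.1, rfl, h.2, hmu⟩
      rw [hs, Finset.sum_singleton, numSkewSYT_self, one_mul]
    · rw [Finset.eq_empty_of_forall_notMem (s := skewIndex m mu nu 0 b), Finset.sum_empty]
      intro lam hlam
      have := huniq lam hlam
      subst this
      obtain ⟨-, h1, -, h2, -⟩ := mem_skewIndex.1 hlam
      exact h ⟨h1, h2⟩
  | succ a ih =>
    rw [List.replicate_succ, List.cons_append, numPaths, sum_left_eq_sum_upSet hmu
      (fun z => numPaths (List.replicate a false ++ List.replicate b true) z (walkState m c nu)),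
      Finset.sum_congr rfl fun lam hlam => ih (Finset.mem_filter.1 hlam).2,
      Finset.sum_comm' (t' := skewIndex m mu nu (a + 1) b)
        (s' := fun lam => (upSet mu).filter (· ≤ lam))]
    · refine Finset.sum_congr rfl fun lam hlam => ?_
      obtain ⟨h1, -, h2, -⟩ := mem_skewIndex.1 hlam
      rw [← Finset.sum_mul, numSkewSYT_eq_sum_up h1 (by omega)]
    · intro mu' lam
      rw [Finset.mem_filter, Finset.mem_filter, mem_upSet, mem_skewIndex, mem_skewIndex]
      constructor
      · rintro ⟨⟨h1, h2⟩, h3, h4, h5, h6, h7⟩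
        have := h1.2
        exact ⟨⟨h1, h3⟩, h1.1.trans h3, h4, by omega, h6, h7⟩
      · rintro ⟨⟨h1, h2⟩, h3, h4, h5, h6, h7⟩
        have := h1.2
        exact ⟨⟨h1, (colLen_mono h2 0).trans h7⟩, h2, h4, by omega, h6, h7⟩

/-! ### Counting the move sequences -/

/-- A unit step cannot jump over a neighbour: the order can only be lost through a collision. -/
theorem strictMono_add_stepVec {m : ℕ} {x : Fin m → ℤ} (hx : StrictMono x) (s : WalkStep m)
    (h : Function.Injective (x + stepVec s)) : StrictMono (x + stepVec s) := by
  rw [strictMono_fin_iff] at hx ⊢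
  intro i j hij
  have h1 := hx i j hij
  have h2 : (x + stepVec s) i ≠ (x + stepVec s) j := fun e => by
    have := h e
    rw [this] at hij
    omega
  have hne : i ≠ j := fun e => by rw [e] at hij; omega
  obtain ⟨k, b⟩ := s
  by_cases hi : i = k
  · have hj : j ≠ k := fun e => hne (hi.trans e.symm)
    cases b <;> simp only [Pi.add_apply, stepVec_true, stepVec_false, if_pos hi, if_neg hj] at * <;>
      omega
  · cases b <;> simp only [Pi.add_apply, stepVec_true, stepVec_false, if_neg hi] at * <;>
      split_ifs at * <;> omega

theorem walkPos_zero {m : ℕ} (x : Fin m → ℤ) (ω : ℕ → WalkStep m) : walkPos x ω 0 = x := by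
  simp [walkPos]

theorem walkPos_succ {m : ℕ} (x : Fin m → ℤ) (ω : ℕ → WalkStep m) (t : ℕ) :
    walkPos x ω (t + 1) = walkPos (x + stepVec (ω 0)) (fun i => ω (i + 1)) t := by
  rw [walkPos, walkPos, Finset.sum_range_succ', add_assoc, add_comm (stepVec (ω 0))]

theorem walkPos_congr {m : ℕ} (x : Fin m → ℤ) {ω ω' : ℕ → WalkStep m} {t : ℕ}
    (h : ∀ i < t, ω i = ω' i) : walkPos x ω t = walkPos x ω' t := by
  rw [walkPos, walkPos, Finset.sum_congr rfl fun i hi => by rw [h i (Finset.mem_range.1 hi)]]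

theorem mem_nonIntersectingEvent_congr {m : ℕ} (x y : Fin m → ℤ) {ω ω' : ℕ → WalkStep m} {T : ℕ}
    (h : ∀ i < T, ω i = ω' i) :
    ω ∈ nonIntersectingEvent x y T ↔ ω' ∈ nonIntersectingEvent x y T := by
  have h1 : ∀ t ≤ T, walkPos x ω t = walkPos x ω' t := fun t ht =>
    walkPos_congr x fun i hi => h i (hi.trans_le ht)
  simp only [nonIntersectingEvent, Set.mem_ofPred_eq, h1 T le_rfl]
  refine and_congr_right fun _ => forall₂_congr fun t ht => ?_
  rw [h1 t ht]

theorem mem_nonIntersectingEvent_succ {m : ℕ} {x : Fin m → ℤ} (hx : StrictMono x) (y : Fin m → ℤ)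
    (ω : ℕ → WalkStep m) (T : ℕ) :
    ω ∈ nonIntersectingEvent x y (T + 1) ↔ StrictMono (x + stepVec (ω 0)) ∧
      (fun i => ω (i + 1)) ∈ nonIntersectingEvent (x + stepVec (ω 0)) y T := by
  simp only [nonIntersectingEvent, Set.mem_ofPred_eq, walkPos_succ]
  constructor
  · rintro ⟨h1, h2⟩
    have h3 : ∀ t ≤ T, Function.Injective
        (walkPos (x + stepVec (ω 0)) (fun i => ω (i + 1)) t) := fun t ht => by
      rw [← walkPos_succ]
      exact h2 (t + 1) (by omega)
    refine ⟨strictMono_add_stepVec hx _ ?_, h1, h3⟩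
    simpa [walkPos_zero] using h3 0 (Nat.zero_le _)
  · rintro ⟨_, h1, h2⟩
    refine ⟨h1, fun t ht => ?_⟩
    cases t with
    | zero => rw [walkPos_zero]; exact hx.injective
    | succ t => rw [walkPos_succ]; exact h2 t (by omega)

/-- Continue a finite move sequence arbitrarily. -/
def extendMoves {m : ℕ} [NeZero m] {T : ℕ} (w : Fin T → WalkStep m) : ℕ → WalkStep m :=
  fun i => if h : i < T then w ⟨i, h⟩ else (0, true)

theorem extendMoves_apply {m : ℕ} [NeZero m] {T : ℕ} (w : Fin T → WalkStep m) {i : ℕ} (h : i < T) :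
    extendMoves w i = w ⟨i, h⟩ := dif_pos h

open Classical in
/-- The number of move sequences of length `T` that realize the event. -/
def numWalks {m : ℕ} [NeZero m] (T : ℕ) (x y : Fin m → ℤ) : ℕ :=
  (Finset.univ.filter fun w : Fin T → WalkStep m =>
    extendMoves w ∈ nonIntersectingEvent x y T).card

open Classical in
theorem numWalks_zero {m : ℕ} [NeZero m] {x : Fin m → ℤ} (hx : StrictMono x) (y : Fin m → ℤ) :
    numWalks 0 x y = if x = y then 1 else 0 := by
  have : ∀ w : Fin 0 → WalkStep m, extendMoves w ∈ nonIntersectingEvent x y 0 ↔ x = y := by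
    intro w
    simp only [nonIntersectingEvent, Set.mem_ofPred_eq, walkPos_zero]
    refine and_iff_left fun t ht => ?_
    obtain rfl : t = 0 := by omega
    rw [walkPos_zero]
    exact hx.injective
  simp only [numWalks, this]
  by_cases h : x = y <;> simp [h]

open Classical in
theorem numWalks_succ {m : ℕ} [NeZero m] (T : ℕ) {x : Fin m → ℤ} (hx : StrictMono x)
    (y : Fin m → ℤ) : numWalks (T + 1) x y =
      ∑ s : WalkStep m, if StrictMono (x + stepVec s) then numWalks T (x + stepVec s) y else 0 := by
  have h0 : numWalks (T + 1) x y = ∑ w : Fin (T + 1) → WalkStep m,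
      if extendMoves w ∈ nonIntersectingEvent x y (T + 1) then 1 else 0 := by
    rw [numWalks, Finset.card_filter]
  rw [h0, ← (Fin.consEquiv (fun _ : Fin (T + 1) => WalkStep m)).sum_comp, Fintype.sum_prod_type]
  refine Finset.sum_congr rfl fun s _ => ?_
  have h1 : ∀ w : Fin T → WalkStep m,
      extendMoves ((Fin.consEquiv (fun _ : Fin (T + 1) => WalkStep m)) (s, w)) ∈
        nonIntersectingEvent x y (T + 1) ↔ StrictMono (x + stepVec s) ∧
        extendMoves w ∈ nonIntersectingEvent (x + stepVec s) y T := by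
    intro w
    rw [mem_nonIntersectingEvent_succ hx]
    have e0 : extendMoves ((Fin.consEquiv (fun _ : Fin (T + 1) => WalkStep m)) (s, w)) 0 = s := by
      rw [extendMoves_apply _ (Nat.succ_pos T)]; rfl
    rw [e0]
    refine and_congr_right fun _ => mem_nonIntersectingEvent_congr _ _ fun i hi => ?_
    rw [extendMoves_apply _ (Nat.succ_lt_succ hi), extendMoves_apply _ hi]
    rfl
  simp only [h1]
  split_ifs with hs
  · rw [numWalks, Finset.card_filter]
    exact Finset.sum_congr rfl fun w _ => if_congr (and_iff_right hs) rfl rfl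
  · exact Finset.sum_eq_zero fun w _ => if_neg fun h => hs h.1

/-- There are `T.choose i` words with `i` left moves, and each contributes as much as the sorted
word. The induction on the first move is Pascal's rule. -/
theorem numWalks_eq_sum_choose {m : ℕ} [NeZero m] (T : ℕ) {x : Fin m → ℤ} (hx : StrictMono x)
    (y : Fin m → ℤ) : numWalks T x y = ∑ ij ∈ Finset.HasAntidiagonal.antidiagonal T,
      T.choose ij.1 • numPaths (List.replicate ij.1 false ++ List.replicate ij.2 true) x y := by
  classical
  induction T generalizing x with
  | zero => simp [numWalks_zero hx, numPaths]
  | succ T ih =>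
    rw [numWalks_succ T hx, Finset.sum_antidiagonal_choose_succ_nsmul
      (fun i j => numPaths (List.replicate i false ++ List.replicate j true) x y),
      Fintype.sum_prod_type_right]
    have hb : ∀ b : Bool, (∑ k : Fin m, if StrictMono (x + stepVec (k, b)) then
        numWalks T (x + stepVec (k, b)) y else 0) = ∑ ij ∈ Finset.HasAntidiagonal.antidiagonal T,
        T.choose ij.1 • numPaths
          (b :: (List.replicate ij.1 false ++ List.replicate ij.2 true)) x y := by
      intro b
      simp only [numPaths, Finset.smul_sum]
      rw [Finset.sum_comm]
      refine Finset.sum_congr rfl fun k _ => ?_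
      split_ifs with hk
      · exact ih hk
      · simp
    rw [Fintype.sum_bool, hb, hb]
    congr 1
    · refine Finset.sum_congr rfl fun ij _ => ?_
      rw [numPaths_perm _ hx]
      rw [List.replicate_succ]
      exact List.perm_middle.symm
    · refine Finset.sum_congr rfl fun ij hij => ?_
      -- In this half of Pascal's rule the coefficient is indexed by the number of right moves,
      -- hence the symmetry of binomials.
      rw [List.replicate_succ, List.cons_append,
        ← Finset.HasAntidiagonal.mem_antidiagonal.1 hij, Nat.choose_symm_add]

/-- Together with `a + b = T` this leaves at most one term in the binomial sum. -/
theorem sum_sub_of_numPaths_ne_zero {m : ℕ} (a b : ℕ) {x y : Fin m → ℤ}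
    (h : numPaths (List.replicate a false ++ List.replicate b true) x y ≠ 0) :
    ∑ k, (x k - y k) = (a : ℤ) - b := by
  induction a generalizing x with
  | zero =>
    rw [List.replicate_zero, List.nil_append] at h
    induction b generalizing x with
    | zero =>
      have : x = y := by
        by_contra hne
        exact h (if_neg hne)
      simp [this]
    | succ b ih =>
      rw [List.replicate_succ, numPaths] at h
      obtain ⟨k, _, hk⟩ := Finset.exists_ne_zero_of_sum_ne_zero h
      have h1 := ih (x := x + stepVec (k, true)) fun h0 => hk (by rw [h0]; simp)
      simp only [Pi.add_apply, stepVec_true, add_sub_right_comm, Finset.sum_add_distrib,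
        Finset.sum_ite_eq', Finset.mem_univ, if_true] at h1
      push_cast at h1 ⊢
      omega
  | succ a ih =>
    rw [List.replicate_succ, List.cons_append, numPaths] at h
    obtain ⟨k, _, hk⟩ := Finset.exists_ne_zero_of_sum_ne_zero h
    have h1 := ih (x := x + stepVec (k, false)) fun h0 => hk (by rw [h0]; simp)
    simp only [Pi.add_apply, stepVec_false, add_sub_right_comm, Finset.sum_add_distrib,
      Finset.sum_ite_eq', Finset.mem_univ, if_true] at h1
    push_cast at h1 ⊢
    omega

theorem numWalks_eq {m : ℕ} [NeZero m] {T : ℕ} {x y : Fin m → ℤ} (hx : StrictMono x)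
    {a b : ℕ} (hT : T = a + b) (hs : ∑ k, (x k - y k) = (a : ℤ) - b) :
    numWalks T x y =
      T.choose a * numPaths (List.replicate a false ++ List.replicate b true) x y := by
  rw [numWalks_eq_sum_choose T hx, Finset.sum_eq_single (a, b)]
  · rfl
  · rintro ⟨i, j⟩ hij hne
    by_contra h0
    have h1 := sum_sub_of_numPaths_ne_zero i j (x := x) (y := y) fun h => h0 (by
      change T.choose i • numPaths _ x y = 0
      rw [h, smul_zero])
    have h2 : i + j = T := Finset.HasAntidiagonal.mem_antidiagonal.1 hij
    exact hne (Prod.ext (by simp only; omega) (by simp only; omega))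
  · intro h
    exact absurd (Finset.HasAntidiagonal.mem_antidiagonal.2 hT.symm) h

theorem numWalks_eq_zero {m : ℕ} [NeZero m] {T : ℕ} {x y : Fin m → ℤ} (hx : StrictMono x)
    (h : ∀ a b : ℕ, T = a + b → ∑ k, (x k - y k) ≠ (a : ℤ) - b) : numWalks T x y = 0 := by
  rw [numWalks_eq_sum_choose T hx]
  refine Finset.sum_eq_zero fun ij hij => ?_
  by_contra h0
  exact h ij.1 ij.2 (Finset.HasAntidiagonal.mem_antidiagonal.1 hij).symm (sum_sub_of_numPaths_ne_zero _ _
    fun h => h0 (by rw [h, smul_zero]))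

/-! ### The probability of a set of move sequences -/

instance {m : ℕ} [NeZero m] : IsProbabilityMeasure (moveLaw m) := by
  unfold moveLaw; infer_instance

theorem moveLaw_prefix {m : ℕ} [NeZero m] {T : ℕ} (w : Fin T → WalkStep m) :
    (moveLaw m).real {ω | ∀ i < T, ω i = extendMoves w i} = 1 / (2 * (m : ℝ)) ^ T := by
  have h1 : {ω : ℕ → WalkStep m | ∀ i < T, ω i = extendMoves w i} =
      Set.pi (Finset.range T) (fun i => {extendMoves w i}) := by
    ext ω
    simp [Set.mem_pi]
  rw [h1, measureReal_def, moveLaw,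
    Measure.infinitePi_pi _ (fun i _ => MeasurableSet.singleton _)]
  simp only [PMF.toMeasure_apply_singleton _ _ (MeasurableSet.singleton _),
    PMF.uniformOfFintype_apply, Finset.prod_const, Finset.card_range, Fintype.card_prod,
    Fintype.card_fin, Fintype.card_bool]
  rw [ENNReal.toReal_pow, ENNReal.toReal_inv]
  push_cast
  simp [mul_comm, ← inv_pow]

/-- The event depends on the first `T` moves only, so it is a finite disjoint union of cylinders of
equal probability. -/
theorem nonIntersectingProb_eq {m : ℕ} [NeZero m] (x y : Fin m → ℤ) (T : ℕ) :
    nonIntersectingProb x y T = 1 / (2 * (m : ℝ)) ^ T * (numWalks T x y : ℝ) := by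
  classical
  set S := Finset.univ.filter fun w : Fin T → WalkStep m =>
    extendMoves w ∈ nonIntersectingEvent x y T with hS
  have h1 : nonIntersectingEvent x y T =
      ⋃ w ∈ S, {ω : ℕ → WalkStep m | ∀ i < T, ω i = extendMoves w i} := by
    ext ω
    simp only [Set.mem_iUnion, Set.mem_ofPred_eq, exists_prop, hS, Finset.mem_filter,
      Finset.mem_univ, true_and]
    constructor
    · intro h
      have h2 : ∀ i < T, ω i = extendMoves (fun i : Fin T => ω i) i := fun i hi => by
        rw [extendMoves_apply _ hi]
      exact ⟨_, (mem_nonIntersectingEvent_congr x y h2).1 h, h2⟩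
    · rintro ⟨w, hw, h⟩
      exact (mem_nonIntersectingEvent_congr x y h).2 hw
  rw [nonIntersectingProb, h1, measureReal_biUnion_finset]
  · rw [Finset.sum_congr rfl fun w _ => moveLaw_prefix w, Finset.sum_const, nsmul_eq_mul, mul_comm]
    rfl
  · intro w _ w' _ hne
    refine Set.disjoint_left.2 fun ω h h' => hne (funext fun i => ?_)
    have := (h i i.2).symm.trans (h' i i.2)
    rwa [extendMoves_apply _ i.2, extendMoves_apply _ i.2] at this
  · intro w _
    have : {ω : ℕ → WalkStep m | ∀ i < T, ω i = extendMoves w i} =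
        Set.pi (Finset.range T) (fun i => {extendMoves w i}) := by
      ext ω
      simp [Set.mem_pi]
    rw [this]
    exact MeasurableSet.pi (Finset.countable_toSet _) fun i _ => MeasurableSet.singleton _

theorem nonIntersectingProb_eq_sum {m : ℕ} [NeZero m] {x y : Fin m → ℤ} (hx : StrictMono x)
    (hy : StrictMono y) {c : ℤ} (hxc : ∀ k : Fin m, x k ≤ c + (k : ℤ))
    (hyc : ∀ k : Fin m, y k ≤ c + (k : ℤ)) {T a b : ℕ} (hT : T = a + b)
    (hs : ∑ k, (x k - y k) = (a : ℤ) - b) :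
    nonIntersectingProb x y T = 1 / (2 * (m : ℝ)) ^ T * (T.choose a : ℝ) *
      ∑ lam ∈ skewIndex m (walkPartition c x hx) (walkPartition c y hy) a b,
        (numSkewSYT lam (walkPartition c x hx) : ℝ) *
          (numSkewSYT lam (walkPartition c y hy) : ℝ) := by
  have h1 := numPaths_left_right_eq (c := c) a b (colLen_walkPartition c x hx)
    (colLen_walkPartition c y hy)
  rw [walkState_walkPartition hx hxc, walkState_walkPartition hy hyc] at h1
  rw [nonIntersectingProb_eq, numWalks_eq hx hT hs, h1]
  push_cast
  ring

theorem sum_sub_eq_card_sub {m : ℕ} {x y : Fin m → ℤ} (hx : StrictMono x)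
    (hy : StrictMono y) {c : ℤ} (hxc : ∀ k : Fin m, x k ≤ c + (k : ℤ))
    (hyc : ∀ k : Fin m, y k ≤ c + (k : ℤ)) :
    ∑ k, (x k - y k) = ((walkPartition c y hy).card : ℤ) - ((walkPartition c x hx).card : ℤ) := by
  rw [card_eq_sum_rowLen (colLen_walkPartition c x hx),
    card_eq_sum_rowLen (colLen_walkPartition c y hy)]
  push_cast
  rw [← Finset.sum_sub_distrib]
  refine Finset.sum_congr rfl fun k _ => ?_
  have := hxc k
  have := hyc k
  rw [rowLen_walkPartition, rowLen_walkPartition]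
  omega

/-! ### Local growth rules -/

/-- `lam \ rho` is a horizontal (or vertical) strip, for diagrams given by their part sizes. -/
def Interlaces (rho lam : ℕ → ℕ) : Prop := ∀ k, lam (k + 1) ≤ rho k ∧ rho k ≤ lam k

/-- The local growth rule of the Robinson-Schensted-Knuth correspondence. -/
def growLocal (X : ℕ) (rho mu nu : ℕ → ℕ) : ℕ → ℕ
  | 0 => max (mu 0) (nu 0) + X
  | k + 1 => max (mu (k + 1)) (nu (k + 1)) + (min (mu k) (nu k) - rho k)

/-- The inverse of the local growth rule. -/
def shrinkLocal (lam mu nu : ℕ → ℕ) : ℕ → ℕ :=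
  fun k => (min (mu k) (nu k) - lam (k + 1)) + max (mu (k + 1)) (nu (k + 1))

/-- Since `rho k ≤ min (mu k) (nu k)`, the truncated subtraction in the rule is exact; since `max
(mu (k + 1)) (nu (k + 1)) ≤ rho k`, the new part does not exceed `min (mu k) (nu k)`. -/
theorem interlaces_growLocal {X : ℕ} {rho mu nu : ℕ → ℕ} (hmu : Interlaces rho mu)
    (hnu : Interlaces rho nu) :
    Interlaces mu (growLocal X rho mu nu) ∧ Interlaces nu (growLocal X rho mu nu) := by
  constructor <;> rintro (_ | k)
  · have := hmu 0; have := hnu 0; simp only [growLocal]; omega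
  · have := hmu k; have := hnu k; have := hmu (k + 1); have := hnu (k + 1)
    simp only [growLocal]; omega
  · have := hmu 0; have := hnu 0; simp only [growLocal]; omega
  · have := hmu k; have := hnu k; have := hmu (k + 1); have := hnu (k + 1)
    simp only [growLocal]; omega

theorem interlaces_shrinkLocal {lam mu nu : ℕ → ℕ} (hmu : Interlaces mu lam)
    (hnu : Interlaces nu lam) :
    Interlaces (shrinkLocal lam mu nu) mu ∧ Interlaces (shrinkLocal lam mu nu) nu := by
  constructor <;> intro k <;> have := hmu k <;> have := hnu k <;> have := hmu (k + 1) <;>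
    have := hnu (k + 1) <;> simp only [shrinkLocal] <;> omega

/-- With `lam` the result of the rule, `lam (k + 1) + rho k = max (mu (k + 1)) (nu (k + 1)) + min
(mu k) (nu k)`, which is solved equally well for either unknown; the entry `X` is kept in `lam 0`.
-/
theorem shrinkLocal_growLocal {X : ℕ} {rho mu nu : ℕ → ℕ} (hmu : Interlaces rho mu)
    (hnu : Interlaces rho nu) : shrinkLocal (growLocal X rho mu nu) mu nu = rho := by
  funext k
  have := hmu k; have := hnu k
  simp only [growLocal, shrinkLocal]
  omega

theorem growLocal_shrinkLocal {lam mu nu : ℕ → ℕ} (hmu : Interlaces mu lam)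
    (hnu : Interlaces nu lam) :
    growLocal (lam 0 - max (mu 0) (nu 0)) (shrinkLocal lam mu nu) mu nu = lam := by
  funext k
  cases k with
  | zero => have := hmu 0; have := hnu 0; simp only [growLocal]; omega
  | succ k =>
    have := hmu k; have := hnu k; have := hmu (k + 1); have := hnu (k + 1)
    simp only [growLocal, shrinkLocal]
    omega

theorem sum_growLocal {X : ℕ} {rho mu nu : ℕ → ℕ} (hmu : Interlaces rho mu)
    (hnu : Interlaces rho nu) (M : ℕ) (hM : nu M = 0) :
    ∑ k ∈ Finset.range (M + 1), growLocal X rho mu nu k + ∑ k ∈ Finset.range (M + 1), rho k =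
      ∑ k ∈ Finset.range (M + 1), mu k + ∑ k ∈ Finset.range (M + 1), nu k + X := by
  -- Each maximum combines with the minimum of the same index to a sum, except for the last minimum
  -- and the last `rho`; both vanish once `nu M = 0`.
  have key : ∀ M, ∑ k ∈ Finset.range (M + 1), growLocal X rho mu nu k +
      ∑ k ∈ Finset.range (M + 1), rho k + min (mu M) (nu M) =
      ∑ k ∈ Finset.range (M + 1), mu k + ∑ k ∈ Finset.range (M + 1), nu k + X + rho M := by
    intro M
    induction M with
    | zero => simp only [zero_add, Finset.sum_range_one, growLocal]; omega
    | succ M ih =>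
      have := hmu M; have := hnu M
      have e : growLocal X rho mu nu (M + 1) =
        max (mu (M + 1)) (nu (M + 1)) + (min (mu M) (nu M) - rho M) := rfl
      rw [Finset.sum_range_succ _ (M + 1), Finset.sum_range_succ _ (M + 1),
        Finset.sum_range_succ _ (M + 1), Finset.sum_range_succ _ (M + 1), e]
      omega
  have := key M
  have := hnu M
  omega

/-! ### Growth diagrams -/

/-- The growth diagram of a matrix of nonnegative integers. -/
def growth (X : ℕ → ℕ → ℕ) : ℕ → ℕ → ℕ → ℕ
  | 0, _ => 0
  | _ + 1, 0 => 0
  | i + 1, j + 1 => growLocal (X i j) (growth X i j) (growth X (i + 1) j) (growth X i (j + 1))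

theorem growth_zero_left (X : ℕ → ℕ → ℕ) (j : ℕ) : growth X 0 j = 0 := by
  simp [growth]

theorem growth_zero_right (X : ℕ → ℕ → ℕ) (i : ℕ) : growth X i 0 = 0 := by
  cases i <;> simp [growth]

theorem growth_succ (X : ℕ → ℕ → ℕ) (i j : ℕ) : growth X (i + 1) (j + 1) =
    growLocal (X i j) (growth X i j) (growth X (i + 1) j) (growth X i (j + 1)) := by
  rw [growth]

theorem interlaces_zero : Interlaces 0 0 := fun _ => ⟨le_rfl, le_rfl⟩

/-- Interlacing along line `i` gives interlacing from line `i` to line `i + 1`, and both together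
give it along line `i + 1`. -/
theorem interlaces_growth (X : ℕ → ℕ → ℕ) (i j : ℕ) :
    Interlaces (growth X i j) (growth X (i + 1) j) ∧
      Interlaces (growth X i j) (growth X i (j + 1)) := by
  have vert : ∀ i, (∀ j, Interlaces (growth X i j) (growth X i (j + 1))) →
      ∀ j, Interlaces (growth X i j) (growth X (i + 1) j) := by
    intro i hi j
    induction j with
    | zero => simpa only [growth_zero_right] using interlaces_zero
    | succ j ih =>
      rw [growth_succ]
      exact (interlaces_growLocal ih (hi j)).2
  have hor : ∀ i j, Interlaces (growth X i j) (growth X i (j + 1)) := by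
    intro i
    induction i with
    | zero => intro j; simpa only [growth_zero_left] using interlaces_zero
    | succ i ih =>
      intro j
      rw [growth_succ]
      exact (interlaces_growLocal (vert i ih j) (ih j)).1
  exact ⟨vert i (hor i) j, hor i j⟩

/-- Each line of the matrix creates at most one new part. This permits cutting off all sums of parts
at a fixed bound. -/
theorem growth_eq_zero (X : ℕ → ℕ → ℕ) {i k : ℕ} (j : ℕ) (h : i ≤ k) : growth X i j k = 0 := by
  induction i generalizing j k with
  | zero => rw [growth_zero_left]; rfl
  | succ i ih =>
    induction j generalizing k with
    | zero => rw [growth_zero_right]; rfl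
    | succ j ihj =>
      obtain ⟨k, rfl⟩ : ∃ k', k = k' + 1 := ⟨k - 1, by omega⟩
      rw [growth_succ]
      have h1 := ihj h
      have h2 := ih (j + 1) (k := k) (by omega)
      have h3 := ih (j + 1) (k := k + 1) (by omega)
      simp only [growLocal, h1, h2, h3]
      omega

/-- The mixed second difference of the sizes is the matrix entry, so increments of size along the
boundary are row and column sums. -/
theorem sum_growth_succ (X : ℕ → ℕ → ℕ) {n i : ℕ} (hi : i ≤ n) (j : ℕ) :
    ∑ k ∈ Finset.range (n + 1), growth X (i + 1) (j + 1) k +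
        ∑ k ∈ Finset.range (n + 1), growth X i j k =
      ∑ k ∈ Finset.range (n + 1), growth X (i + 1) j k +
        ∑ k ∈ Finset.range (n + 1), growth X i (j + 1) k + X i j := by
  rw [growth_succ]
  exact sum_growLocal (interlaces_growth X i j).1 (interlaces_growth X i j).2 n
    (growth_eq_zero X _ hi)

theorem sum_growth_succ_left (X : ℕ → ℕ → ℕ) {n i : ℕ} (hi : i ≤ n) (j : ℕ) :
    ∑ k ∈ Finset.range (n + 1), growth X (i + 1) j k =
      ∑ k ∈ Finset.range (n + 1), growth X i j k + ∑ b ∈ Finset.range j, X i b := by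
  induction j with
  | zero => simp [growth_zero_right]
  | succ j ih =>
    have := sum_growth_succ X hi j
    rw [Finset.sum_range_succ _ j]
    omega

theorem sum_growth_succ_right (X : ℕ → ℕ → ℕ) {n i : ℕ} (hi : i ≤ n + 1) (j : ℕ) :
    ∑ k ∈ Finset.range (n + 1), growth X i (j + 1) k =
      ∑ k ∈ Finset.range (n + 1), growth X i j k + ∑ a ∈ Finset.range i, X a j := by
  induction i with
  | zero => simp [growth_zero_left]
  | succ i ih =>
    have := sum_growth_succ X (show i ≤ n by omega) j
    have := ih (by omega)
    rw [Finset.sum_range_succ _ i]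
    omega

theorem growth_congr {X Y : ℕ → ℕ → ℕ} {n : ℕ} (h : ∀ i < n, ∀ j < n, X i j = Y i j) {i j : ℕ}
    (hi : i ≤ n) (hj : j ≤ n) : growth X i j = growth Y i j := by
  induction i generalizing j with
  | zero => rw [growth_zero_left, growth_zero_left]
  | succ i ih =>
    induction j with
    | zero => rw [growth_zero_right, growth_zero_right]
    | succ j ihj =>
      rw [growth_succ, growth_succ, ih (by omega) (by omega), ih (by omega) hj, ihj (by omega),
        h i (by omega) j (by omega)]

/-- The matrix is determined by the boundary of the growth diagram. -/
theorem growth_boundary_inj {X Y : ℕ → ℕ → ℕ} {n : ℕ}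
    (h1 : ∀ j ≤ n, growth X n j = growth Y n j) (h2 : ∀ i ≤ n, growth X i n = growth Y i n) :
    ∀ i < n, ∀ j < n, X i j = Y i j := by
  -- Induction away from the corner `(n, n)`, undoing the local rule; indices truncated to `0` fall
  -- on the axes, where both diagrams vanish.
  have key : ∀ a b, growth X (n - a) (n - b) = growth Y (n - a) (n - b) := by
    intro a
    induction a with
    | zero => exact fun b => h1 _ (Nat.sub_le _ _)
    | succ a iha =>
      intro b
      induction b with
      | zero => exact h2 _ (Nat.sub_le _ _)
      | succ b ihb =>
        by_cases ha : n ≤ a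
        · rw [show n - (a + 1) = 0 by omega, growth_zero_left, growth_zero_left]
        by_cases hb : n ≤ b
        · rw [show n - (b + 1) = 0 by omega, growth_zero_right, growth_zero_right]
        have e1 := iha b
        have e2 := iha (b + 1)
        rw [show n - a = n - (a + 1) + 1 by omega] at e1 e2
        rw [show n - b = n - (b + 1) + 1 by omega] at e1 ihb
        generalize n - (a + 1) = i at *
        generalize n - (b + 1) = j at *
        rw [growth_succ, growth_succ] at e1
        have hX := interlaces_growth X i j
        have hY := interlaces_growth Y i j
        rw [← shrinkLocal_growLocal (X := X i j) hX.1 hX.2,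
          ← shrinkLocal_growLocal (X := Y i j) hY.1 hY.2, e1, e2, ihb]
  intro i hi j hj
  have e := fun a b => key (n - a) (n - b)
  have h1 := e (i + 1) (j + 1)
  have h2 := e (i + 1) j
  have h3 := e i (j + 1)
  rw [Nat.sub_sub_self (by omega), Nat.sub_sub_self (by omega)] at h1 h2 h3
  -- With all four corners of the cell known, the first part reveals the matrix entry.
  have h4 := congrFun h1 0
  rw [growth_succ, growth_succ, h2, h3] at h4
  simp only [growLocal] at h4
  omega

/-- The array obtained from its boundary by the inverse local rule. -/
def shrinkArray (P Q : ℕ → ℕ → ℕ) : ℕ → ℕ → ℕ → ℕ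
  | 0, b => P b
  | a + 1, 0 => Q (a + 1)
  | a + 1, b + 1 => shrinkLocal (shrinkArray P Q a b) (shrinkArray P Q a (b + 1))
      (shrinkArray P Q (a + 1) b)

theorem interlaces_shrinkArray {P Q : ℕ → ℕ → ℕ} (h0 : P 0 = Q 0)
    (hP : ∀ b, Interlaces (P (b + 1)) (P b)) (hQ : ∀ a, Interlaces (Q (a + 1)) (Q a)) (a b : ℕ) :
    Interlaces (shrinkArray P Q (a + 1) b) (shrinkArray P Q a b) ∧
      Interlaces (shrinkArray P Q a (b + 1)) (shrinkArray P Q a b) := by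
  have vert : ∀ a, (∀ b, Interlaces (shrinkArray P Q a (b + 1)) (shrinkArray P Q a b)) →
      ∀ b, Interlaces (shrinkArray P Q (a + 1) b) (shrinkArray P Q a b) := by
    intro a ha b
    induction b with
    | zero =>
      have := hQ a
      cases a with
      | zero => rw [shrinkArray, shrinkArray, h0]; exact this
      | succ a => rw [shrinkArray, shrinkArray]; exact this
    | succ b ih =>
      rw [shrinkArray]
      exact (interlaces_shrinkLocal (ha b) ih).1
  have hor : ∀ a b, Interlaces (shrinkArray P Q a (b + 1)) (shrinkArray P Q a b) := by
    intro a
    induction a with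
    | zero => intro b; rw [shrinkArray, shrinkArray]; exact hP b
    | succ a ih =>
      intro b
      rw [shrinkArray]
      exact (interlaces_shrinkLocal (ih b) (vert a ih b)).2
  exact ⟨vert a (hor a) b, hor a b⟩

/-- Every pair of interlacing chains with the same end bounds a growth diagram. -/
theorem exists_growth_boundary {n : ℕ} {P Q : ℕ → ℕ → ℕ} (h0 : P n = Q n) (hP0 : P 0 = 0)
    (hQ0 : Q 0 = 0) (hP : ∀ j < n, Interlaces (P j) (P (j + 1)))
    (hQ : ∀ i < n, Interlaces (Q i) (Q (i + 1))) :
    ∃ X : ℕ → ℕ → ℕ, (∀ j ≤ n, growth X n j = P j) ∧ ∀ i ≤ n, growth X i n = Q i := by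
  have hrev : ∀ R : ℕ → ℕ → ℕ, R 0 = 0 → (∀ j < n, Interlaces (R j) (R (j + 1))) →
      ∀ b, Interlaces (R (n - (b + 1))) (R (n - b)) := by
    intro R hR0 hR b
    by_cases hb : n ≤ b
    · rw [show n - (b + 1) = 0 by omega, show n - b = 0 by omega, hR0]
      exact interlaces_zero
    · rw [show n - b = n - (b + 1) + 1 by omega]
      exact hR _ (by omega)
  -- The indices of `M` count steps back from the corner `(n, n)`.
  set M := shrinkArray (fun b => P (n - b)) (fun a => Q (n - a)) with hM
  have hI := interlaces_shrinkArray (P := fun b => P (n - b)) (Q := fun a => Q (n - a)) h0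
    (hrev P hP0 hP) (hrev Q hQ0 hQ)
  rw [← hM] at hI
  have hM0 : ∀ b, M 0 b = P (n - b) := fun b => by rw [hM, shrinkArray]
  have hM0' : ∀ a, M a 0 = Q (n - a) := fun a => by
    cases a with
    | zero => rw [hM0]; exact h0
    | succ a => rw [hM, shrinkArray]
  -- Interlacing makes entries decrease away from the boundary, and the chain already starts at `0`;
  -- so the array vanishes on the axes, as a growth diagram must.
  have hMn : ∀ a, M a n = 0 := by
    intro a
    induction a with
    | zero => rw [hM0, Nat.sub_self, hP0]
    | succ a ih =>
      funext k
      have := ((hI a n).1 k).2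
      rw [ih] at this
      exact Nat.le_zero.1 this
  have hMn' : ∀ b, M n b = 0 := by
    intro b
    induction b with
    | zero => rw [hM0', Nat.sub_self, hQ0]
    | succ b ih =>
      funext k
      have := ((hI n b).2 k).2
      rw [ih] at this
      exact Nat.le_zero.1 this
  -- The entry is the excess of the first part over what the local rule gives for an entry `0`.
  set X : ℕ → ℕ → ℕ := fun i j => M (n - (i + 1)) (n - (j + 1)) 0 -
    max (M (n - (i + 1)) (n - j) 0) (M (n - i) (n - (j + 1)) 0) with hX
  have key : ∀ i ≤ n, ∀ j ≤ n, growth X i j = M (n - i) (n - j) := by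
    intro i
    induction i with
    | zero => intro _ j _; rw [growth_zero_left, Nat.sub_zero, hMn']
    | succ i ih =>
      intro hi j
      induction j with
      | zero => intro _; rw [growth_zero_right, Nat.sub_zero, hMn]
      | succ j ihj =>
        intro hj
        rw [growth_succ, ih (by omega) j (by omega), ihj (by omega), ih (by omega) _ hj, hX]
        simp only
        rw [show n - i = n - (i + 1) + 1 by omega, show n - j = n - (j + 1) + 1 by omega]
        generalize n - (i + 1) = a
        generalize n - (j + 1) = b
        have h3 : M (a + 1) (b + 1) = shrinkLocal (M a b) (M a (b + 1)) (M (a + 1) b) := by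
          rw [hM, shrinkArray]
        rw [h3]
        exact growLocal_shrinkLocal (hI a b).2 (hI a b).1
  refine ⟨X, fun j hj => ?_, fun i hi => ?_⟩
  · rw [key n le_rfl j hj, Nat.sub_self, hM0, Nat.sub_sub_self hj]
  · rw [key i hi n le_rfl, Nat.sub_self, hM0', Nat.sub_sub_self hi]

/-! ### Permutation matrices and increasing subsequences -/

open Classical in
/-- The matrix of a permutation. -/
def permMatrix {n : ℕ} (π : Equiv.Perm (Fin n)) (i j : ℕ) : ℕ :=
  if ∃ a : Fin n, (a : ℕ) = i ∧ (π a : ℕ) = j then 1 else 0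

theorem permMatrix_apply {n : ℕ} (π : Equiv.Perm (Fin n)) (a b : Fin n) :
    permMatrix π a b = if π a = b then 1 else 0 := by
  rw [permMatrix]
  refine if_congr ⟨?_, fun h => ⟨a, rfl, congrArg Fin.val h⟩⟩ rfl rfl
  rintro ⟨a', h1, h2⟩
  rw [← Fin.ext h1]
  exact Fin.ext h2

theorem sum_permMatrix_row {n : ℕ} (π : Equiv.Perm (Fin n)) (a : Fin n) :
    ∑ j ∈ Finset.range n, permMatrix π a j = 1 := by
  rw [← Fin.sum_univ_eq_sum_range (fun j => permMatrix π a j)]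
  simp [permMatrix_apply]

theorem sum_permMatrix_col {n : ℕ} (π : Equiv.Perm (Fin n)) (b : Fin n) :
    ∑ i ∈ Finset.range n, permMatrix π i b = 1 := by
  rw [← Fin.sum_univ_eq_sum_range (fun i => permMatrix π i b)]
  simp [permMatrix_apply, ← Equiv.eq_symm_apply]

theorem exists_permMatrix {n : ℕ} {X : ℕ → ℕ → ℕ}
    (h1 : ∀ i < n, ∑ j ∈ Finset.range n, X i j = 1)
    (h2 : ∀ j < n, ∑ i ∈ Finset.range n, X i j = 1) :
    ∃ π : Equiv.Perm (Fin n), ∀ i < n, ∀ j < n, X i j = permMatrix π i j := by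
  have one : ∀ f : Fin n → ℕ, ∑ b, f b = 1 → ∃ b, f b = 1 ∧ ∀ b', b' ≠ b → f b' = 0 := by
    intro f hf
    obtain ⟨b, _, hb⟩ := Finset.exists_ne_zero_of_sum_ne_zero (hf ▸ one_ne_zero)
    have hsum := Finset.add_sum_erase Finset.univ f (Finset.mem_univ b)
    refine ⟨b, by omega, fun b' hb' => ?_⟩
    have : ∑ b ∈ Finset.univ.erase b, f b = 0 := by omega
    exact Finset.sum_eq_zero_iff.1 this b' (Finset.mem_erase.2 ⟨hb', Finset.mem_univ _⟩)
  have hrow : ∀ a : Fin n, ∃ b : Fin n, X a b = 1 ∧ ∀ b', b' ≠ b → X a b' = 0 := fun a =>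
    one (fun b => X a b) (by rw [Fin.sum_univ_eq_sum_range (fun j => X a j)]; exact h1 a a.2)
  have hcol : ∀ b : Fin n, ∃ a : Fin n, X a b = 1 ∧ ∀ a', a' ≠ a → X a' b = 0 := fun b =>
    one (fun a => X a b) (by rw [Fin.sum_univ_eq_sum_range (fun i => X i b)]; exact h2 b b.2)
  choose f hf hf' using hrow
  choose g hg hg' using hcol
  have hfg : ∀ b, f (g b) = b := fun b => by
    by_contra hne
    have := hf' (g b) b (Ne.symm hne)
    rw [hg] at this
    exact one_ne_zero this
  have hgf : ∀ a, g (f a) = a := fun a => by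
    by_contra hne
    have := hg' (f a) a (Ne.symm hne)
    rw [hf] at this
    exact one_ne_zero this
  refine ⟨⟨f, g, hgf, hfg⟩, fun i hi j hj => ?_⟩
  have := permMatrix_apply (⟨f, g, hgf, hfg⟩ : Equiv.Perm (Fin n)) ⟨i, hi⟩ ⟨j, hj⟩
  rw [show permMatrix _ i j = _ from this]
  split_ifs with h
  · have h3 := hf ⟨i, hi⟩
    rw [show f ⟨i, hi⟩ = ⟨j, hj⟩ from h] at h3
    exact h3
  · exact hf' ⟨i, hi⟩ ⟨j, hj⟩ fun e => h e.symm

theorem permMatrix_inj {n : ℕ} {π σ : Equiv.Perm (Fin n)}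
    (h : ∀ i < n, ∀ j < n, permMatrix π i j = permMatrix σ i j) : π = σ := by
  ext a
  have := h a a.2 (π a) (π a).2
  rw [permMatrix_apply, permMatrix_apply, if_pos rfl] at this
  by_contra hne
  rw [if_neg fun e => hne (congrArg Fin.val e).symm] at this
  exact one_ne_zero this

/-! ### First parts of the growth diagram as lengths of increasing subsequences. -/

theorem growth_permMatrix_head_succ {n : ℕ} (π : Equiv.Perm (Fin n)) (i j : ℕ) :
    growth (permMatrix π) (i + 1) (j + 1) 0 = max (growth (permMatrix π) (i + 1) j 0)
      (growth (permMatrix π) i (j + 1) 0) + permMatrix π i j := by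
  rw [growth_succ]; rfl

/-- If the subsequence uses the point in the corner cell, that point is its last one and the rest
fits into the rectangle `i` by `j`. Otherwise it misses the last line or the last value and fits
into a smaller rectangle. -/
theorem card_le_growth {n : ℕ} (π : Equiv.Perm (Fin n)) (i j : ℕ) (s : Finset (Fin n))
    (hs : StrictMonoOn π (s : Set (Fin n))) (hi : ∀ a ∈ s, (a : ℕ) < i)
    (hj : ∀ a ∈ s, (π a : ℕ) < j) : s.card ≤ growth (permMatrix π) i j 0 := by
  induction i generalizing j s with
  | zero =>
    rw [Finset.eq_empty_of_forall_notMem fun a ha => absurd (hi a ha) (Nat.not_lt_zero _)]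
    exact Nat.zero_le _
  | succ i ih =>
    induction j generalizing s with
    | zero =>
      rw [Finset.eq_empty_of_forall_notMem fun a ha => absurd (hj a ha) (Nat.not_lt_zero _)]
      exact Nat.zero_le _
    | succ j ihj =>
      rw [growth_permMatrix_head_succ]
      by_cases hlast : ∃ a ∈ s, (a : ℕ) = i
      · obtain ⟨a, ha, hai⟩ := hlast
        have hlt : ∀ b ∈ s, b ≠ a → (b : ℕ) < i ∧ (π b : ℕ) < π a := by
          intro b hb hba
          have h1 := hi b hb
          have h2 : (b : ℕ) ≠ a := fun e => hba (Fin.ext e)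
          have h3 : b < a := Fin.lt_def.2 (by omega)
          exact ⟨by omega, hs hb ha h3⟩
        have haj := hj a ha
        by_cases hpi : (π a : ℕ) = j
        · have hX : permMatrix π i j = 1 := if_pos ⟨a, hai, hpi⟩
          have h1 := ih j (s.erase a)
            (hs.mono (by simp))
            (fun b hb => (hlt b (Finset.mem_of_mem_erase hb) (Finset.ne_of_mem_erase hb)).1)
            (fun b hb =>
              (hlt b (Finset.mem_of_mem_erase hb) (Finset.ne_of_mem_erase hb)).2.trans_eq hpi)
          rw [Finset.card_erase_of_mem ha] at h1
          have h2 := ((interlaces_growth (permMatrix π) i j).1 0).2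
          omega
        · have h1 := ihj s hs hi fun b hb => by
            by_cases hba : b = a
            · subst hba; omega
            · have := (hlt b hb hba).2; omega
          omega
      · have h1 := ih (j + 1) s hs (fun a ha => by
          have h1 := hi a ha
          have h2 : (a : ℕ) ≠ i := fun e => hlast ⟨a, ha, e⟩
          omega) hj
        omega

theorem exists_card_eq_growth {n : ℕ} (π : Equiv.Perm (Fin n)) (i j : ℕ) :
    ∃ s : Finset (Fin n), StrictMonoOn π (s : Set (Fin n)) ∧ (∀ a ∈ s, (a : ℕ) < i) ∧
      (∀ a ∈ s, (π a : ℕ) < j) ∧ s.card = growth (permMatrix π) i j 0 := by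
  induction i generalizing j with
  | zero => exact ⟨∅, by simp [StrictMonoOn], by simp, by simp, by simp [growth_zero_left]⟩
  | succ i ih =>
    induction j with
    | zero => exact ⟨∅, by simp [StrictMonoOn], by simp, by simp, by simp [growth_zero_right]⟩
    | succ j ihj =>
      rw [growth_permMatrix_head_succ]
      obtain ⟨s, hs, hi, hj, hc⟩ := ihj
      obtain ⟨s', hs', hi', hj', hc'⟩ := ih (j + 1)
      -- The final clause records that `t` misses the last line or the last value. Hence a point in
      -- the corner cell is new and lies strictly beyond all of `t`.
      obtain ⟨t, ht, hti, htj, htc, htX⟩ : ∃ t : Finset (Fin n),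
          StrictMonoOn π (t : Set (Fin n)) ∧ (∀ a ∈ t, (a : ℕ) < i + 1) ∧
          (∀ a ∈ t, (π a : ℕ) < j + 1) ∧ t.card = max (growth (permMatrix π) (i + 1) j 0)
            (growth (permMatrix π) i (j + 1) 0) ∧
          ((∀ a ∈ t, (a : ℕ) < i) ∨ ∀ a ∈ t, (π a : ℕ) < j) := by
        rcases le_total (growth (permMatrix π) (i + 1) j 0)
          (growth (permMatrix π) i (j + 1) 0) with h | h
        · exact ⟨s', hs', fun a ha => (hi' a ha).trans (Nat.lt_succ_self i), hj',
            by rw [max_eq_right h, hc'], Or.inl hi'⟩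
        · exact ⟨s, hs, hi, fun a ha => (hj a ha).trans (Nat.lt_succ_self j),
            by rw [max_eq_left h, hc], Or.inr hj⟩
      by_cases hX : ∃ a : Fin n, (a : ℕ) = i ∧ (π a : ℕ) = j
      · have hX1 : permMatrix π i j = 1 := if_pos hX
        obtain ⟨a, hai, haj⟩ := hX
        have hat : a ∉ t := by
          intro ha
          rcases htX with h | h
          · have := h a ha; omega
          · have := h a ha; omega
        have hlt : ∀ b ∈ t, b < a ∧ π b < π a := by
          intro b hb
          have h1 : b ≠ a := fun e => hat (e ▸ hb)
          have h2 : (b : ℕ) ≠ a := fun e => h1 (Fin.ext e)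
          have h3 : (π b : ℕ) ≠ π a := fun e => h1 (π.injective (Fin.ext e))
          have := hti b hb
          have := htj b hb
          exact ⟨Fin.lt_def.2 (by omega), Fin.lt_def.2 (by omega)⟩
        refine ⟨insert a t, ?_, ?_, ?_, ?_⟩
        · intro b hb c hc hbc
          rw [Finset.mem_coe, Finset.mem_insert] at hb hc
          rcases hb with rfl | hb <;> rcases hc with rfl | hc
          · exact absurd hbc (lt_irrefl _)
          · exact absurd (hbc.trans (hlt c hc).1) (lt_irrefl _)
          · exact (hlt b hb).2
          · exact ht hb hc hbc
        · intro b hb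
          rcases Finset.mem_insert.1 hb with rfl | hb
          · omega
          · exact hti b hb
        · intro b hb
          rcases Finset.mem_insert.1 hb with rfl | hb
          · omega
          · exact htj b hb
        · rw [Finset.card_insert_of_notMem hat, htc, hX1]
      · have hX0 : permMatrix π i j = 0 := if_neg hX
        exact ⟨t, ht, hti, htj, by rw [htc, hX0, add_zero]⟩

theorem longestIncreasing_eq_growth {n : ℕ} (π : Equiv.Perm (Fin n)) :
    longestIncreasing π = growth (permMatrix π) n n 0 := by
  classical
  apply le_antisymm
  · refine Finset.sup_le fun s hs => ?_
    exact card_le_growth π n n s (Finset.mem_filter.1 hs).2 (fun a _ => a.2) fun a _ => (π a).2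
  · obtain ⟨s, hs, -, -, hc⟩ := exists_card_eq_growth π n n
    rw [← hc, longestIncreasing]
    refine Finset.le_sup (f := Finset.card) ?_
    rw [Finset.mem_filter]
    exact ⟨Finset.mem_univ _, hs⟩

/-! ### Chains of diagrams -/

theorem colLen_injective {mu lam : YoungDiagram} (h : mu.colLen = lam.colLen) : mu = lam := by
  refine YoungDiagram.ext (Finset.ext fun c => ?_)
  rw [YoungDiagram.mem_cells, YoungDiagram.mem_cells, show c = (c.1, c.2) from rfl,
    YoungDiagram.mem_iff_lt_colLen, YoungDiagram.mem_iff_lt_colLen, h]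

theorem card_eq_sum_colLen {lam : YoungDiagram} {N : ℕ} (h : lam.colLen N = 0) :
    lam.card = ∑ k ∈ Finset.range N, lam.colLen k := by
  change lam.cells.card = _
  rw [Finset.card_eq_sum_card_fiberwise (f := Prod.snd) (t := Finset.range N)]
  · refine Finset.sum_congr rfl fun i _ => ?_
    rw [YoungDiagram.colLen_eq_card]; rfl
  · rintro ⟨i, j⟩ hij
    simp only [Finset.coe_range, Set.mem_Iio]
    by_contra hlt
    have h1 := YoungDiagram.mem_iff_lt_colLen.1 ((YoungDiagram.mem_cells _).1 hij)
    have := lam.colLen_anti N j (not_lt.1 hlt)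
    omega

theorem exists_youngDiagram_colLen {f : ℕ → ℕ} (hf : Antitone f) {N : ℕ} (hN : f N = 0) :
    ∃ lam : YoungDiagram, lam.colLen = f := by
  let cells := (Finset.range (f 0) ×ˢ Finset.range N).filter fun c => c.1 < f c.2
  have hmem : ∀ i j, (i, j) ∈ cells ↔ i < f j := by
    intro i j
    simp only [cells, Finset.mem_filter, Finset.mem_product, Finset.mem_range]
    refine ⟨fun h => h.2, fun h => ⟨⟨h.trans_le (hf (Nat.zero_le j)), ?_⟩, h⟩⟩
    by_contra hlt
    have := hf (not_lt.1 hlt)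
    omega
  have hlow : IsLowerSet (cells : Set (ℕ × ℕ)) := by
    rintro ⟨i, j⟩ ⟨i', j'⟩ hle hij
    obtain ⟨h1, h2⟩ := Prod.le_def.1 hle
    have h3 := (hmem i j).1 hij
    exact (hmem i' j').2 (lt_of_le_of_lt h1 (h3.trans_le (hf h2)))
  refine ⟨⟨cells, hlow⟩, funext fun j => eq_of_forall_lt_iff fun i => ?_⟩
  rw [← YoungDiagram.mem_iff_lt_colLen]
  exact hmem i j

/-- If column `k + 1` of `lam` were longer than column `k` of `mu`, the row just below the latter
would contain two new boxes. -/
theorem AddsBox.interlaces {mu lam : YoungDiagram} (h : AddsBox mu lam) :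
    Interlaces mu.colLen lam.colLen := by
  intro k
  refine ⟨?_, colLen_mono h.1 k⟩
  by_contra hlt
  obtain ⟨c, -, hc⟩ := h.exists_cell
  have key : ∀ j, (mu.colLen k, j) ∈ lam → k ≤ j → (mu.colLen k, j) = c := by
    intro j h1 h2
    rw [← YoungDiagram.mem_cells, hc, Finset.mem_insert] at h1
    refine h1.resolve_right fun h3 => ?_
    have h4 := YoungDiagram.mem_iff_lt_colLen.1 ((YoungDiagram.mem_cells _).1 h3)
    have := mu.colLen_anti k j h2
    omega
  have h1 : (mu.colLen k, k + 1) ∈ lam := YoungDiagram.mem_iff_lt_colLen.2 (not_le.1 hlt)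
  have h2 := key (k + 1) h1 (Nat.le_succ k)
  have h3 := key k (lam.up_left_mem le_rfl (Nat.le_succ k) h1) le_rfl
  have := congrArg Prod.snd (h2.trans h3.symm)
  simp at this

theorem addsBox_of_interlaces {mu lam : YoungDiagram} (h : Interlaces mu.colLen lam.colLen)
    (hc : lam.card = mu.card + 1) : AddsBox mu lam := by
  refine ⟨?_, hc⟩
  rintro ⟨i, j⟩ hij
  exact YoungDiagram.mem_iff_lt_colLen.2 ((YoungDiagram.mem_iff_lt_colLen.1 hij).trans_le (h j).2)

/-- A chain of diagrams starting at the empty diagram and adding one box at a time. -/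
def IsChainFromBot {n : ℕ} (p : Fin (n + 1) → YoungDiagram) : Prop :=
  p 0 = ⊥ ∧ ∀ j : Fin n, AddsBox (p j.castSucc) (p j.succ)

theorem IsChainFromBot.card_eq {n : ℕ} {p : Fin (n + 1) → YoungDiagram} (h : IsChainFromBot p)
    (j : Fin (n + 1)) : (p j).card = j := by
  induction j using Fin.induction with
  | zero => rw [h.1]; rfl
  | succ j ih => rw [(h.2 j).2, ih]; simp

/-- The chains ending at a given diagram. -/
abbrev ChainsTo (n : ℕ) (lam : YoungDiagram) : Type :=
  {p : Fin (n + 1) → YoungDiagram // IsChainFromBot p ∧ p (Fin.last n) = lam}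

theorem isChainFromBot_snoc {n : ℕ} {p : Fin (n + 1) → YoungDiagram} {lam : YoungDiagram} :
    IsChainFromBot (Fin.snoc p lam : Fin (n + 2) → YoungDiagram) ↔
      IsChainFromBot p ∧ AddsBox (p (Fin.last n)) lam := by
  unfold IsChainFromBot
  rw [Fin.forall_fin_succ', and_assoc]
  refine and_congr ?_ (and_congr (forall_congr' fun j => ?_) ?_)
  · rw [show (0 : Fin (n + 2)) = Fin.castSucc 0 from rfl, Fin.snoc_castSucc]
  · rw [Fin.succ_castSucc, Fin.snoc_castSucc, Fin.snoc_castSucc]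
  · rw [Fin.succ_last, Fin.snoc_last, Fin.snoc_castSucc]

/-- Dropping the last diagram of a chain and the largest label of a tableau give the same recursion.
Finiteness is carried along because counting a sigma type requires finite fibres. -/
theorem finite_and_card_chainsTo (n : ℕ) (lam : YoungDiagram) (hlam : lam.card = n) :
    Finite (ChainsTo n lam) ∧ Nat.card (ChainsTo n lam) = numSYT lam := by
  induction n generalizing lam with
  | zero =>
    have hbot : lam = ⊥ := YoungDiagram.ext (Finset.card_eq_zero.1 hlam)
    subst hbot
    have hu : Unique (ChainsTo 0 ⊥) :=
      ⟨⟨⟨fun _ => ⊥, ⟨rfl, fun j => j.elim0⟩, rfl⟩⟩, fun p => Subtype.ext (funext fun j => by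
        rw [Fin.fin_one_eq_zero j]; exact p.2.1.1)⟩
    refine ⟨inferInstance, ?_⟩
    rw [Nat.card_unique, numSYT_eq_numSkewSYT_bot, numSkewSYT_self]
  | succ n ih =>
    have hdown : ∀ mu : {mu // mu ∈ downSet lam}, mu.1.card = n := fun mu => by
      have := (mem_downSet.1 mu.2).2
      omega
    let Φ : (Σ mu : {mu // mu ∈ downSet lam}, ChainsTo n mu.1) → ChainsTo (n + 1) lam := fun q =>
      ⟨Fin.snoc q.2.1 lam, isChainFromBot_snoc.2
        ⟨q.2.2.1, by rw [q.2.2.2]; exact mem_downSet.1 q.1.2⟩, by simp⟩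
    have hΦ : Function.Bijective Φ := by
      constructor
      · rintro ⟨⟨mu, hmu⟩, ⟨p, hp, hpl⟩⟩ ⟨⟨mu', hmu'⟩, ⟨p', hp', hpl'⟩⟩ h
        have h1 : (Fin.snoc p lam : Fin (n + 2) → YoungDiagram) = Fin.snoc p' lam :=
          congrArg Subtype.val h
        have h2 : p = p' := by
          rw [← Fin.init_snoc (α := fun _ => YoungDiagram) lam p, h1, Fin.init_snoc]
        clear h
        subst h2
        obtain rfl : mu = mu' := hpl.symm.trans hpl'
        rfl
      · rintro ⟨p, hp, hpl⟩
        have hs : (Fin.snoc (Fin.init p) lam : Fin (n + 2) → YoungDiagram) = p := by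
          rw [← hpl, Fin.snoc_init_self]
        have hp' := hp
        rw [← hs, isChainFromBot_snoc] at hp'
        exact ⟨⟨⟨_, mem_downSet.2 hp'.2⟩, ⟨Fin.init p, hp'.1, rfl⟩⟩, Subtype.ext hs⟩
    have hfin : ∀ mu : {mu // mu ∈ downSet lam}, Finite (ChainsTo n mu.1) := fun mu =>
      (ih mu.1 (hdown mu)).1
    refine ⟨Finite.of_surjective Φ hΦ.2, ?_⟩
    classical
    rw [← Nat.card_eq_of_bijective Φ hΦ, Nat.card_sigma,
      Finset.sum_congr rfl fun mu _ => (ih mu.1 (hdown mu)).2,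
      Finset.sum_coe_sort (downSet lam) numSYT, numSYT_eq_numSkewSYT_bot,
      numSkewSYT_eq_sum_down bot_le (by rw [hlam]; exact Nat.succ_ne_zero n)]
    rw [Finset.filter_true_of_mem fun _ _ => bot_le]
    exact Finset.sum_congr rfl fun mu _ => numSYT_eq_numSkewSYT_bot mu

theorem mem_partitionsWithin {m n : ℕ} {lam : YoungDiagram} :
    lam ∈ partitionsWithin m n ↔ lam.card = n ∧ lam.colLen 0 ≤ m := by
  simp [partitionsWithin]

/-- Pairs of chains of length `n` with the same end, a diagram with at most `m` rows. -/
abbrev ChainPairs (m n : ℕ) : Type :=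
  {pq : (Fin (n + 1) → YoungDiagram) × (Fin (n + 1) → YoungDiagram) //
    IsChainFromBot pq.1 ∧ IsChainFromBot pq.2 ∧ pq.1 (Fin.last n) = pq.2 (Fin.last n) ∧
      (pq.1 (Fin.last n)).colLen 0 ≤ m}

theorem card_chainPairs (m n : ℕ) :
    Nat.card (ChainPairs m n) = ∑ lam ∈ partitionsWithin m n, numSYT lam ^ 2 := by
  have hcard : ∀ lam : {lam // lam ∈ partitionsWithin m n}, lam.1.card = n := fun lam =>
    (mem_partitionsWithin.1 lam.2).1
  let Φ : (Σ lam : {lam // lam ∈ partitionsWithin m n}, ChainsTo n lam.1 × ChainsTo n lam.1) →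
      ChainPairs m n := fun q => ⟨(q.2.1.1, q.2.2.1), q.2.1.2.1, q.2.2.2.1,
        q.2.1.2.2.trans q.2.2.2.2.symm,
        (congrArg (fun lam => lam.colLen 0) q.2.1.2.2).trans_le (mem_partitionsWithin.1 q.1.2).2⟩
  have hΦ : Function.Bijective Φ := by
    constructor
    · rintro ⟨⟨l, hl⟩, ⟨⟨p, hp, hpl⟩, ⟨q, hq, hql⟩⟩⟩ ⟨⟨l', hl'⟩, ⟨⟨p', hp', hpl'⟩, ⟨q', hq', hql'⟩⟩⟩ h
      have h1 : (p, q) = (p', q') := congrArg Subtype.val h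
      obtain ⟨rfl, rfl⟩ := Prod.mk.inj h1
      clear h h1
      obtain rfl : l = l' := hpl.symm.trans hpl'
      rfl
    · rintro ⟨⟨p, q⟩, hp, hq, hpq, hm⟩
      exact ⟨⟨⟨p (Fin.last n), mem_partitionsWithin.2 ⟨hp.card_eq _, hm⟩⟩,
        ⟨p, hp, rfl⟩, ⟨q, hq, hpq.symm⟩⟩, rfl⟩
  have hfin : ∀ lam : {lam // lam ∈ partitionsWithin m n}, Finite (ChainsTo n lam.1) := fun lam =>
    (finite_and_card_chainsTo n lam.1 (hcard lam)).1
  rw [← Nat.card_eq_of_bijective Φ hΦ, Nat.card_sigma,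
    ← Finset.sum_coe_sort (partitionsWithin m n) (fun lam => numSYT lam ^ 2)]
  refine Finset.sum_congr rfl fun lam _ => ?_
  rw [Nat.card_prod, (finite_and_card_chainsTo n lam.1 (hcard lam)).2, sq]

/-! ### The Robinson-Schensted correspondence -/

/-- Interlacing with the next entry puts a number between any two consecutive parts, which are
therefore weakly decreasing. -/
theorem exists_colLen_eq_growth (X : ℕ → ℕ → ℕ) (i j : ℕ) :
    ∃ lam : YoungDiagram, lam.colLen = growth X i j :=
  exists_youngDiagram_colLen
    (antitone_nat_of_succ_le fun k =>
      ((interlaces_growth X i j).1 (k + 1)).2.trans ((interlaces_growth X i j).1 k).1)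
    (growth_eq_zero X j le_rfl)

/-- The entry of the growth diagram as a Young diagram, given by its columns. -/
def growthDiagram (X : ℕ → ℕ → ℕ) (i j : ℕ) : YoungDiagram := (exists_colLen_eq_growth X i j).choose

theorem colLen_growthDiagram (X : ℕ → ℕ → ℕ) (i j : ℕ) :
    (growthDiagram X i j).colLen = growth X i j := (exists_colLen_eq_growth X i j).choose_spec

theorem card_growthDiagram (X : ℕ → ℕ → ℕ) {n i : ℕ} (hi : i ≤ n + 1) (j : ℕ) :
    (growthDiagram X i j).card = ∑ k ∈ Finset.range (n + 1), growth X i j k := by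
  rw [card_eq_sum_colLen (N := n + 1), colLen_growthDiagram]
  rw [colLen_growthDiagram]
  exact growth_eq_zero X j hi

theorem colLen_bot : (⊥ : YoungDiagram).colLen = 0 := by
  funext k
  by_contra hne
  exact YoungDiagram.notMem_bot (0, k)
    (YoungDiagram.mem_iff_lt_colLen.2 (Nat.pos_of_ne_zero hne))

theorem isChainFromBot_growth_right {n : ℕ} (π : Equiv.Perm (Fin n)) :
    IsChainFromBot fun j : Fin (n + 1) => growthDiagram (permMatrix π) n j := by
  constructor
  · apply colLen_injective
    rw [colLen_growthDiagram, colLen_bot, Fin.val_zero, growth_zero_right]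
  · intro j
    apply addsBox_of_interlaces
    · rw [colLen_growthDiagram, colLen_growthDiagram]
      exact (interlaces_growth _ _ _).2
    · rw [card_growthDiagram _ (Nat.le_succ n), card_growthDiagram _ (Nat.le_succ n), Fin.val_succ,
        sum_growth_succ_right _ (Nat.le_succ n), sum_permMatrix_col, Fin.val_castSucc]

theorem isChainFromBot_growth_left {n : ℕ} (π : Equiv.Perm (Fin n)) :
    IsChainFromBot fun i : Fin (n + 1) => growthDiagram (permMatrix π) i n := by
  constructor
  · apply colLen_injective
    rw [colLen_growthDiagram, colLen_bot, Fin.val_zero, growth_zero_left]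
  · intro i
    apply addsBox_of_interlaces
    · rw [colLen_growthDiagram, colLen_growthDiagram]
      exact (interlaces_growth _ _ _).1
    · rw [card_growthDiagram (n := n) _ (by simp only [Fin.val_succ]; omega),
        card_growthDiagram (n := n) _ (by simp only [Fin.val_castSucc]; omega), Fin.val_succ,
        sum_growth_succ_left _ i.2.le, sum_permMatrix_row, Fin.val_castSucc]

theorem exists_perm_of_chains {n : ℕ} {p q : Fin (n + 1) → YoungDiagram} (hp : IsChainFromBot p)
    (hq : IsChainFromBot q) (hpq : p (Fin.last n) = q (Fin.last n)) :
    ∃ π : Equiv.Perm (Fin n), (∀ j : Fin (n + 1), growthDiagram (permMatrix π) n j = p j) ∧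
      ∀ i : Fin (n + 1), growthDiagram (permMatrix π) i n = q i := by
  -- Beyond `n` the index wraps around modulo `n + 1`; only indices up to `n` are used.
  let ext : (Fin (n + 1) → YoungDiagram) → ℕ → ℕ → ℕ := fun p j =>
    (p (Fin.ofNat (n + 1) j)).colLen
  have hext : ∀ p (j : Fin (n + 1)), ext p j = (p j).colLen := fun p j => by
    simp only [ext, Fin.ofNat_eq_cast, Fin.cast_val_eq_self]
  have hext0 : ∀ p, IsChainFromBot p → ext p 0 = 0 := fun p hp => by
    rw [show ext p 0 = _ from hext p 0, hp.1, colLen_bot]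
  have hextn : ∀ p, ext p n = (p (Fin.last n)).colLen := fun p => hext p (Fin.last n)
  have hexts : ∀ p, IsChainFromBot p → ∀ j < n, Interlaces (ext p j) (ext p (j + 1)) := by
    intro p hp j hj
    have h1 := hext p (Fin.castSucc ⟨j, hj⟩)
    have h2 := hext p (Fin.succ ⟨j, hj⟩)
    simp only [Fin.val_castSucc, Fin.val_succ] at h1 h2
    rw [h1, h2]
    exact (hp.2 ⟨j, hj⟩).interlaces
  obtain ⟨X, hX1, hX2⟩ := exists_growth_boundary (n := n) (P := ext p) (Q := ext q)
    (by rw [hextn, hextn, hpq]) (hext0 p hp) (hext0 q hq) (hexts p hp) (hexts q hq)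
  have h1 : ∀ j : Fin (n + 1), growthDiagram X n j = p j := fun j => colLen_injective (by
    rw [colLen_growthDiagram, hX1 j (Nat.lt_succ_iff.1 j.2), hext])
  have h2 : ∀ i : Fin (n + 1), growthDiagram X i n = q i := fun i => colLen_injective (by
    rw [colLen_growthDiagram, hX2 i (Nat.lt_succ_iff.1 i.2), hext])
  -- Each step of a chain adds one box, so all row and column sums of `X` are `1`.
  obtain ⟨π, hπ⟩ := exists_permMatrix (n := n) (X := X)
    (by
      intro i hi
      have e1 := hq.card_eq (Fin.castSucc ⟨i, hi⟩)
      have e2 := hq.card_eq (Fin.succ ⟨i, hi⟩)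
      rw [← h2, card_growthDiagram (n := n) _ (by simp only [Fin.val_castSucc]; omega)] at e1
      rw [← h2, card_growthDiagram (n := n) _ (by simp only [Fin.val_succ]; omega)] at e2
      simp only [Fin.val_castSucc, Fin.val_succ] at e1 e2
      rw [sum_growth_succ_left X hi.le] at e2
      omega)
    (by
      intro j hj
      have e1 := hp.card_eq (Fin.castSucc ⟨j, hj⟩)
      have e2 := hp.card_eq (Fin.succ ⟨j, hj⟩)
      rw [← h1, card_growthDiagram (n := n) _ (Nat.le_succ n)] at e1 e2
      simp only [Fin.val_castSucc, Fin.val_succ] at e1 e2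
      rw [sum_growth_succ_right X (Nat.le_succ n)] at e2
      omega)
  refine ⟨π, fun j => ?_, fun i => ?_⟩
  · rw [← h1]
    apply colLen_injective
    rw [colLen_growthDiagram, colLen_growthDiagram]
    exact (growth_congr hπ le_rfl (Nat.lt_succ_iff.1 j.2)).symm
  · rw [← h2]
    apply colLen_injective
    rw [colLen_growthDiagram, colLen_growthDiagram]
    exact (growth_congr hπ (Nat.lt_succ_iff.1 i.2) le_rfl).symm

/-- A permutation is sent to the two far sides of its growth diagram. The boundary determines the
matrix, every pair of chains with a common end occurs, and the first column of that end has length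
`longestIncreasing π`. -/
theorem card_longestIncreasing_le (m n : ℕ) :
    Nat.card {π : Equiv.Perm (Fin n) // longestIncreasing π ≤ m} =
      ∑ lam ∈ partitionsWithin m n, numSYT lam ^ 2 := by
  rw [← card_chainPairs]
  have hlen : ∀ π : Equiv.Perm (Fin n),
      (growthDiagram (permMatrix π) n (Fin.last n)).colLen 0 = longestIncreasing π := fun π => by
    rw [colLen_growthDiagram, longestIncreasing_eq_growth, Fin.val_last]
  let Φ : {π : Equiv.Perm (Fin n) // longestIncreasing π ≤ m} → ChainPairs m n := fun π =>
    ⟨(fun j => growthDiagram (permMatrix π.1) n j, fun i => growthDiagram (permMatrix π.1) i n),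
      isChainFromBot_growth_right π.1, isChainFromBot_growth_left π.1, rfl,
      (hlen π.1).trans_le π.2⟩
  refine Nat.card_eq_of_bijective Φ ⟨?_, ?_⟩
  · intro π σ h
    have h0 := congrArg Subtype.val h
    have h1 := (Prod.mk.inj h0).1
    have h2 := (Prod.mk.inj h0).2
    refine Subtype.ext (permMatrix_inj (growth_boundary_inj ?_ ?_))
    · intro j hj
      have := congrFun h1 ⟨j, Nat.lt_succ_of_le hj⟩
      rw [← colLen_growthDiagram, ← colLen_growthDiagram]
      exact congrArg YoungDiagram.colLen this
    · intro i hi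
      have := congrFun h2 ⟨i, Nat.lt_succ_of_le hi⟩
      rw [← colLen_growthDiagram, ← colLen_growthDiagram]
      exact congrArg YoungDiagram.colLen this
  · rintro ⟨⟨p, q⟩, hp, hq, hpq, hm⟩
    obtain ⟨π, h1, h2⟩ := exists_perm_of_chains hp hq hpq
    refine ⟨⟨π, ?_⟩, Subtype.ext (Prod.ext (funext h1) (funext h2))⟩
    rw [← hlen, h1]
    exact hm

/-! ### The main theorem -/

theorem skewIndex_bot (m n : ℕ) : skewIndex m ⊥ ⊥ n n = partitionsWithin m n := by
  ext lam
  rw [mem_skewIndex, mem_partitionsWithin]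
  have h0 : (⊥ : YoungDiagram).card = 0 := rfl
  rw [h0, zero_add]
  exact ⟨fun h => ⟨h.2.2.1, h.2.2.2.2⟩, fun h => ⟨bot_le, bot_le, h.1, h.1, h.2⟩⟩

theorem strictMono_close_packed (m : ℕ) : StrictMono fun k : Fin m => (k : ℤ) + 1 := by
  intro i j hij
  have : (i : ℕ) < j := hij
  simp only
  omega

/-- With walkers indexed from `0`, the choice `c = 1` makes every row empty. -/
theorem walkPartition_close_packed (m : ℕ) :
    walkPartition 1 (fun k : Fin m => (k : ℤ) + 1) (strictMono_close_packed m) = ⊥ := by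
  refine YoungDiagram.ext (Finset.card_eq_zero.1 ?_)
  refine (card_eq_sum_rowLen (colLen_walkPartition _ _ _)).trans (Finset.sum_eq_zero fun k _ => ?_)
  rw [rowLen_walkPartition]
  omega

theorem nonIntersectingProb_close_packed (m : ℕ) [NeZero m] (n : ℕ) :
    nonIntersectingProb (fun k : Fin m => (k : ℤ) + 1) (fun k : Fin m => (k : ℤ) + 1) (2 * n) =
      1 / (2 * (m : ℝ)) ^ (2 * n) * ((2 * n).choose n : ℝ) *
        ∑ lam ∈ partitionsWithin m n, (numSYT lam : ℝ) ^ 2 := by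
  rw [nonIntersectingProb_eq_sum (strictMono_close_packed m) (strictMono_close_packed m) (c := 1)
    (fun k => by omega) (fun k => by omega) (two_mul n) (by simp), walkPartition_close_packed,
    skewIndex_bot]
  congr 1
  refine Finset.sum_congr rfl fun lam _ => ?_
  rw [numSYT_eq_numSkewSYT_bot, sq]

end

theorem mainTheorem12 (m : ℕ) [NeZero m] :
    (∀ (x y : Fin m → ℤ) (hx : StrictMono x) (hy : StrictMono y) (c : ℤ),
      (∀ k : Fin m, x k ≤ c + (k : ℤ)) → (∀ k : Fin m, y k ≤ c + (k : ℤ)) →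
      ∀ T : ℕ,
        (∀ TL TR : ℕ,
          (TL : ℝ) = (1 / 2) * ((T : ℝ) + ∑ k, ((x k : ℝ) - (y k : ℝ))) →
          (TR : ℝ) = (1 / 2) * ((T : ℝ) - ∑ k, ((x k : ℝ) - (y k : ℝ))) →
          (TL : ℝ) = (1 / 2) * ((T : ℝ) - ((walkPartition c x hx).card : ℝ)
              + ((walkPartition c y hy).card : ℝ)) ∧
          (TR : ℝ) = (1 / 2) * ((T : ℝ) + ((walkPartition c x hx).card : ℝ)
              - ((walkPartition c y hy).card : ℝ)) ∧
          T = TL + TR ∧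
          ∑ k, (x k - y k) = (TL : ℤ) - (TR : ℤ) ∧
          nonIntersectingProb x y T =
            1 / (2 * (m : ℝ)) ^ T * (T.choose TL : ℝ) *
              ∑ lam ∈ skewIndex m (walkPartition c x hx) (walkPartition c y hy) TL TR,
                (numSkewSYT lam (walkPartition c x hx) : ℝ) *
                  (numSkewSYT lam (walkPartition c y hy) : ℝ)) ∧
        ((¬ ∃ TL TR : ℕ,
            (TL : ℝ) = (1 / 2) * ((T : ℝ) + ∑ k, ((x k : ℝ) - (y k : ℝ))) ∧
            (TR : ℝ) = (1 / 2) * ((T : ℝ) - ∑ k, ((x k : ℝ) - (y k : ℝ)))) →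
          nonIntersectingProb x y T = 0)) ∧
    (∀ n : ℕ,
      nonIntersectingProb (fun k : Fin m => (k : ℤ) + 1) (fun k : Fin m => (k : ℤ) + 1) (2 * n) =
          1 / (2 * (m : ℝ)) ^ (2 * n) * ((2 * n).choose n : ℝ) *
            ∑ lam ∈ partitionsWithin m n, (numSYT lam : ℝ) ^ 2 ∧
      nonIntersectingProb (fun k : Fin m => (k : ℤ) + 1) (fun k : Fin m => (k : ℤ) + 1) (2 * n) =
          ((2 * n).factorial : ℝ) / (n.factorial : ℝ) ^ 2 *
            (Nat.card {π : Equiv.Perm (Fin n) // longestIncreasing π ≤ m} : ℝ) /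
              (2 * (m : ℝ)) ^ (2 * n)) := by
  refine ⟨fun x y hx hy c hxc hyc T => ⟨fun TL TR hTL hTR => ?_, fun hno => ?_⟩, fun n => ?_⟩
  · have hR : ∑ k, ((x k : ℝ) - (y k : ℝ)) = ((∑ k, (x k - y k) : ℤ) : ℝ) := by push_cast; rfl
    have hT : T = TL + TR := by
      have : (T : ℝ) = (TL : ℝ) + TR := by rw [hTL, hTR]; ring
      exact_mod_cast this
    have hs : ∑ k, (x k - y k) = (TL : ℤ) - (TR : ℤ) := by
      have : ((∑ k, (x k - y k) : ℤ) : ℝ) = (TL : ℝ) - TR := by rw [← hR, hTL, hTR]; ring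
      exact_mod_cast this
    have hc : ∑ k, ((x k : ℝ) - (y k : ℝ)) =
        ((walkPartition c y hy).card : ℝ) - ((walkPartition c x hx).card : ℝ) := by
      rw [hR, sum_sub_eq_card_sub hx hy hxc hyc]
      push_cast
      rfl
    refine ⟨?_, ?_, hT, hs, nonIntersectingProb_eq_sum hx hy hxc hyc hT hs⟩
    · rw [hTL, hc]; ring
    · rw [hTR, hc]; ring
  · rw [nonIntersectingProb_eq, numWalks_eq_zero hx, Nat.cast_zero, mul_zero]
    -- Any split of `T` compatible with the displacement would supply the excluded `TL` and `TR`.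
    intro a b hab hs
    have hR : ∑ k, ((x k : ℝ) - (y k : ℝ)) = (a : ℝ) - b := by
      have : ((∑ k, (x k - y k) : ℤ) : ℝ) = (a : ℝ) - b := by rw [hs]; push_cast; rfl
      rw [← this]
      push_cast
      rfl
    refine hno ⟨a, b, ?_, ?_⟩ <;> rw [hR, hab] <;> push_cast <;> ring
  · refine ⟨nonIntersectingProb_close_packed m n, ?_⟩
    rw [nonIntersectingProb_close_packed, card_longestIncreasing_le,
      Nat.choose_eq_factorial_div_factorial (by omega : n ≤ 2 * n),
      Nat.cast_div (Nat.factorial_mul_factorial_dvd_factorial (by omega)) (by positivity),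
      show 2 * n - n = n by omega]
    push_cast
    ring
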